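/- Let $C$ be a set of $m\ge 1$ candidates and let $\mathbf P=(P_1,\dots,P_n)$ be a partial voting profile, that is, a sequence of $n\ge 0$ partial orders (reflexive, antisymmetric, transitive relations) on $C$. A completion of $\mathbf P$ is a sequence $\mathbf T=(T_1,\dots,T_n)$ of linear orders on $C$ such that $T_i$ extends $P_i$ for every $i$. In $\mathbf T$, the plurality score of a candidate is the number of $i$ such that it is first in $T_i$; the veto score of a candidate is the number of $i$ such that it is not last in $T_i$. Write $s(\mathbf T,c)$ for the score of $c$ under the chosen rule. Let the tiebreaker $\succ$ be a strict linear order on $C$. The rank of $c$ in $\mathbf T$ is its position, counted from $1$, in the linear order on $C$ that puts $a$ before $b$ if and only if $s(\mathbf T,a)>s(\mathbf T,b)$, or $s(\mathbf T,a)=s(\mathbf T,b)$ and $a\succ b$. The minimal rank $\min(c\mid\mathbf P,\succ)$ is the smallest rank of $c$ over all completions $\mathbf T$ of $\mathbf P$. Theorem. For every fixed integer $k\ge 1$, and for each of the two rules plurality and veto, the following decision problem is solvable in polynomial time: given $C$, a partial voting profile $\mathbf P$ over $C$, a tiebreaker $\succ$ and a candidate $c\in C$, decide whether $\min(c\mid\mathbf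 P,\succ)<k$. Here $k$ is not part of the input, and the polynomial may depend on $k$; the partial orders and the tiebreaker are given explicitly as matrices of bits, and solvable in polynomial time means that some Turing machine decides the problem on every such input in a number of steps bounded by a polynomial in the length of the input. -/

import Mathlib

namespace PartialVoting

/-- A positional scoring rule: `score m j` is the score of the `j`-th position (counted from `1`)
among `m` candidates. -/
structure PositionalScoringRule where
  score : ℕ → ℕ → ℕ
  antitone : ∀ m i j, 1 ≤ i → i ≤ j → j ≤ m → score m j ≤ score m i
  nontrivial : ∀ m, 2 ≤ m → score m m < score m 1

/-- The plurality rule `(1, 0, …, 0)`. -/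
def plurality : PositionalScoringRule where
  score _ j := if j = 1 then 1 else 0
  antitone m i j hi hij _ := by
    split_ifs <;> omega
  nontrivial m hm := by
    have h : m ≠ 1 := by omega
    simp [h]

/-- The veto rule `(1, …, 1, 0)`. -/
def veto : PositionalScoringRule where
  score m j := if j = m then 0 else 1
  antitone m i j _ hij hj := by
    split_ifs <;> omega
  nontrivial m hm := by
    have h : 1 ≠ m := by omega
    simp [h]

open Classical in
/-- The position (counted from `1`) of `a` in a linear order `R`, where `R b a` says that `b`
comes before `a`; it does not matter whether `R` is reflexive or strict. -/
noncomputable def position {m : ℕ} (R : Fin m → Fin m → Prop) (a : Fin m) : ℕ :=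
  (Finset.univ.filter fun b => b ≠ a ∧ R b a).card + 1

/-- The total score of `c` in the complete profile `T` (`T i a b`: voter `i` ranks `a` at or
above `b`). -/
noncomputable def totalScore (r : PositionalScoringRule) {m n : ℕ}
    (T : Fin n → Fin m → Fin m → Prop) (c : Fin m) : ℕ :=
  ∑ i, r.score m (position (T i) c)

/-- The order that sorts the candidates by score and then by the tiebreaker. -/
def resultOrder (r : PositionalScoringRule) {m n : ℕ} (T : Fin n → Fin m → Fin m → Prop)
    (tie : Fin m → Fin m → Prop) (a b : Fin m) : Prop :=
  totalScore r T b < totalScore r T a ∨ (totalScore r T a = totalScore r T b ∧ tie a b)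

/-- The rank of `c` in the complete profile `T` under the tiebreaker `tie`. -/
noncomputable def rank (r : PositionalScoringRule) {m n : ℕ} (T : Fin n → Fin m → Fin m → Prop)
    (tie : Fin m → Fin m → Prop) (c : Fin m) : ℕ :=
  position (resultOrder r T tie) c

/-- `T` is a completion of the partial profile `P`: every `T i` is a linear extension of `P i`. -/
def IsCompletion {m n : ℕ} (P T : Fin n → Fin m → Fin m → Prop) : Prop :=
  ∀ i, IsLinearOrder (Fin m) (T i) ∧ ∀ a b, P i a b → T i a b

/-- The set of ranks that `c` gets in the completions of `P`. -/
def ranks (r : PositionalScoringRule) {m n : ℕ} (P : Fin n → Fin m → Fin m → Prop)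
    (tie : Fin m → Fin m → Prop) (c : Fin m) : Set ℕ :=
  {x | ∃ T, IsCompletion P T ∧ x = rank r T tie c}

/-- The minimal rank of `c` over all completions of `P`. -/
noncomputable def minRank (r : PositionalScoringRule) {m n : ℕ}
    (P : Fin n → Fin m → Fin m → Prop) (tie : Fin m → Fin m → Prop) (c : Fin m) : ℕ :=
  sInf (ranks r P tie c)

/-- The set of ranks is never empty, so that `minRank` is attained. -/
theorem ranks_nonempty (r : PositionalScoringRule) {m n : ℕ} (P : Fin n → Fin m → Fin m → Prop)
    (hP : ∀ i, IsPartialOrder (Fin m) (P i)) (tie : Fin m → Fin m → Prop) (c : Fin m) :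
    (ranks r P tie c).Nonempty := by
  have h : ∀ i, ∃ s : Fin m → Fin m → Prop, IsLinearOrder (Fin m) s ∧ P i ≤ s := fun i =>
    haveI := hP i
    extend_partialOrder (P i)
  choose T hT hle using h
  exact ⟨_, T, fun i => ⟨hT i, fun a b hab => hle i a b hab⟩, rfl⟩

/-- The input of the problem: `m` candidates, `n` voters with partial orders `pref i`
(`pref i a b`: voter `i` weakly prefers `a` to `b`), a tiebreaker `tie` (`tie a b`: the tiebreaker
puts `a` before `b`), and a candidate. -/
@[ext]
structure Election where
  m : ℕ
  n : ℕ
  pref : Fin n → Fin m → Fin m → Prop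
  pref_partialOrder : ∀ i, IsPartialOrder (Fin m) (pref i)
  tie : Fin m → Fin m → Prop
  tie_linearOrder : IsStrictTotalOrder (Fin m) tie
  candidate : Fin m

/-- The alphabet in which inputs are written: bits and two end markers. -/
inductive Symbol where
  | bit (b : Bool)
  | endRow
  | endBlock
  deriving DecidableEq, Fintype

open Classical in
/-- A subset of the candidates, as a row of `m` bits. -/
noncomputable def encodeRow {m : ℕ} (s : Fin m → Prop) : List Symbol :=
  (List.ofFn fun a => Symbol.bit (decide (s a))) ++ [Symbol.endRow]

/-- A relation on the candidates, as an `m × m` matrix of bits. -/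
noncomputable def encodeRel {m : ℕ} (R : Fin m → Fin m → Prop) : List Symbol :=
  (List.ofFn fun a => encodeRow (R a)).flatten ++ [Symbol.endBlock]

/-- An input as a word: the candidate, the tiebreaker, and the partial order of every voter. -/
noncomputable def Election.encode (I : Election) : List Symbol :=
  encodeRow (fun a => a = I.candidate) ++ encodeRel I.tie ++
    (List.ofFn fun i => encodeRel (I.pref i)).flatten

theorem length_encodeRow {m : ℕ} (s : Fin m → Prop) : (encodeRow s).length = m + 1 := by
  simp [encodeRow]

theorem length_encodeRel {m : ℕ} (R : Fin m → Fin m → Prop) :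
    (encodeRel R).length = m * (m + 1) + 1 := by
  simp [encodeRel, Function.comp_def, List.map_ofFn, length_encodeRow]

/-- The length of the word is polynomial in the numbers of candidates and voters. -/
theorem Election.length_encode (I : Election) :
    I.encode.length = I.m + 1 + (I.n + 1) * (I.m * (I.m + 1) + 1) := by
  simp [Election.encode, Function.comp_def, List.map_ofFn, length_encodeRow, length_encodeRel]
  ring

theorem encodeRow_injective {m : ℕ} : Function.Injective (encodeRow (m := m)) := by
  intro s t h
  have h1 := List.ofFn_injective (List.append_cancel_right h)
  funext a
  have h2 := congrFun h1 a
  simpa using h2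

theorem flatten_ofFn_injective {α : Type} (ℓ : ℕ) :
    ∀ {n : ℕ} (f g : Fin n → List α), (∀ i, (f i).length = ℓ) → (∀ i, (g i).length = ℓ) →
      (List.ofFn f).flatten = (List.ofFn g).flatten → f = g := by
  intro n
  induction n with
  | zero => intro f g _ _ _; exact Subsingleton.elim _ _
  | succ n ih =>
    intro f g hf hg h
    simp only [List.ofFn_succ, List.flatten_cons] at h
    obtain ⟨h0, h1⟩ := List.append_inj h ((hf 0).trans (hg 0).symm)
    have h2 := ih _ _ (fun i => hf i.succ) (fun i => hg i.succ) h1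
    funext i
    refine Fin.cases h0 (fun j => congrFun h2 j) i

theorem encodeRel_injective {m : ℕ} : Function.Injective (encodeRel (m := m)) := by
  intro R S h
  have h1 := flatten_ofFn_injective (m + 1) _ _ (fun _ => length_encodeRow _)
    (fun _ => length_encodeRow _) (List.append_cancel_right h)
  funext a
  exact encodeRow_injective (congrFun h1 a)

/-- The first end marker of the word tells the number of candidates. -/
theorem length_takeWhile_encodeRow_append {m : ℕ} (s : Fin m → Prop) (l : List Symbol) :
    ((encodeRow s ++ l).takeWhile (fun x => decide (x ≠ Symbol.endRow))).length = m := by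
  unfold encodeRow
  rw [List.append_assoc, List.takeWhile_append_of_pos]
  · simp
  · intro x hx
    obtain ⟨a, rfl⟩ := (List.mem_ofFn' _ _).1 hx
    simp

/-- Different inputs have different words. -/
theorem Election.encode_injective : Function.Injective Election.encode := by
  rintro ⟨m, n, P, hP, t, ht, c⟩ ⟨m', n', P', hP', t', ht', c'⟩ h
  have hl := congrArg List.length h
  simp only [Election.length_encode] at hl
  simp only [Election.encode, List.append_assoc] at h
  have hm : m = m' := by
    have h1 := congrArg
      (fun l => (l.takeWhile (fun x => decide (x ≠ Symbol.endRow))).length) h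
    simpa only [length_takeWhile_encodeRow_append] using h1
  subst hm
  have hn : n = n' := by
    have h1 := Nat.eq_of_mul_eq_mul_right (Nat.succ_pos _) (Nat.add_left_cancel hl)
    omega
  subst hn
  obtain ⟨h1, h2⟩ := List.append_inj h (by simp only [length_encodeRow])
  obtain ⟨h3, h4⟩ := List.append_inj h2 (by simp only [length_encodeRel])
  have hc : c = c' := by
    have := congrFun (encodeRow_injective h1) c
    simpa using this
  have ht : t = t' := encodeRel_injective h3
  have hp : P = P' := by
    have := flatten_ofFn_injective _ _ _ (fun _ => length_encodeRel _)
      (fun _ => length_encodeRel _) h4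
    funext i
    exact encodeRel_injective (congrFun this i)
  subst hc ht hp
  rfl

open Classical in
/-- The decision problem `Q` on inputs of type `α`, written as words by `enc`, is solvable in
polynomial time: some (multi-stack) Turing machine halts on the word of every input `a` within a
number of steps that is polynomial in the length of the word, and outputs the truth value
of `Q a`. -/
def PolyTimeDecidable {α Γ : Type} (enc : α → List Γ) (Q : α → Prop) : Prop :=
  Nonempty (Turing.TM2ComputableInPolyTime enc Computability.encodeBool fun a => decide (Q a))

end PartialVoting

/-!
The proof has two halves: a combinatorial description of the elections with minimal rank below
`k`, and a proof that this description can be checked by a Turing machine in polynomial time.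

*Combinatorics.* The rank of `c` is one more than the number of candidates that end up before it,
so rank below `1` is impossible, and for `k = K + 2` one may guess a set of at most `K` candidates
that are allowed to beat `c` (`Election.minRank_plurality_lt_iff_existsAdding`,
`Election.minRank_veto_lt_iff_existsAdding`). As `K` is fixed, there are polynomially many guesses.
Plurality only sees the first place of every voter, and any candidate that is maximal in the
partial order can be made first; dually, veto only sees the last place. For plurality, one may
give `c` the vote of every voter who can put it first, since that only lowers the rank of `c`;
the other voters have to be distributed so that no candidate outside the guessed set gets too many
votes, which is a matching of voters to places of candidates (`Election.goodVotes_iff`). For veto,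
`c` is put last only by voters who must do so, and every candidate outside the guessed
set demands a certain number of vetoes, which is a matching of demands to voters
(`Election.goodVetoes_iff`).

*Matching.* Whether a bipartite graph has a matching that covers the active left vertices is
decided by an auction. Right vertices have owners and prices; in every round an unmatched left
vertex takes a neighbour of least price and raises that price by one. The prices of an auction
on a graph with a matching stay bounded (`Auction.Valid.price_lt`), so that within a polynomial
number of rounds the auction either succeeds or shows that there is no matching
(`Auction.run_matched_iff`). In contrast to augmenting paths, a round is a one-step update of
the table of owners and prices.

*Machines.* `Expr` is a small language of expressions over a list of variables, with
arithmetic, bounded sums and bounded iteration, in which every value is of polynomial size. Every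
expression is evaluated by a while-program on stacks in polynomially many steps
(`Expr.exists_compileSpec`), and while-programs are simulated by Mathlib's multi-stack machines
(`Cmd.Exec.reach`). A function or predicate is `Feasible` or a `FeasiblePred` if an
expression computes it; the closure properties of these two notions reduce the complexity claim
to writing the predicates above with bounded quantifiers and bounded counting.
-/

namespace PartialVoting

open Turing Function

/-! ### While-programs on stacks, and their translation to Turing machines -/

/-- The memory of a while-program: registers indexed by `ℕ`, each holding a stack. -/
abbrev Store := ℕ → List Symbol

/-- While-programs on stacks. `move k l` moves one symbol, and `ite k p c d` branches on the top of
stack `k`, which is `none` if the stack is empty. -/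
inductive Cmd where
  | push (k : ℕ) (a : Symbol)
  | pop (k : ℕ)
  | move (k l : ℕ)
  | seq (c d : Cmd)
  | ite (k : ℕ) (p : Option Symbol → Bool) (c d : Cmd)
  | whl (k : ℕ) (c : Cmd)

namespace Cmd

/-- The effect of moving the top of stack `k`, if there is one, to stack `l`. -/
def moveStore (s : Store) (k l : ℕ) : Store :=
  match s k with
  | [] => s
  | a :: t => update (update s k t) l (a :: update s k t l)

/-- Big-step semantics: `Exec c s s' t` says that `c` takes the store `s` to `s'` in `t` steps.
A loop `whl k c` runs `c` as long as the stack `k` is nonempty. -/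
inductive Exec : Cmd → Store → Store → ℕ → Prop
  | push (k a s) : Exec (push k a) s (update s k (a :: s k)) 1
  | pop (k s) : Exec (pop k) s (update s k (s k).tail) 1
  | move (k l s) : Exec (move k l) s (moveStore s k l) 1
  | seq {c d s s' s'' t t'} : Exec c s s' t → Exec d s' s'' t' → Exec (seq c d) s s'' (t + t')
  | ite_true {k p c d s s' t} : p (s k).head? = true → Exec c s s' t →
      Exec (ite k p c d) s s' (1 + t)
  | ite_false {k p c d s s' t} : p (s k).head? = false → Exec d s s' t →
      Exec (ite k p c d) s s' (1 + t)
  | whl_nil {k c s} : s k = [] → Exec (whl k c) s s 1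
  | whl_cons {k c s s' s'' t t'} : s k ≠ [] → Exec c s s' t → Exec (whl k c) s' s'' t' →
      Exec (whl k c) s s'' (1 + t + t')

/-- All registers of the program are at most `n`, so that a machine with finitely many stacks can
run it. -/
def RegLE (n : ℕ) : Cmd → Prop
  | push k _ => k ≤ n
  | pop k => k ≤ n
  | move k l => k ≤ n ∧ l ≤ n
  | seq c d => RegLE n c ∧ RegLE n d
  | ite k _ c d => k ≤ n ∧ RegLE n c ∧ RegLE n d
  | whl k c => k ≤ n ∧ RegLE n c

theorem RegLE.mono {n n' : ℕ} (h : n ≤ n') : ∀ {c : Cmd}, c.RegLE n → c.RegLE n'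
  | push _ _, hc => le_trans hc h
  | pop _, hc => le_trans hc h
  | move _ _, hc => ⟨le_trans hc.1 h, le_trans hc.2 h⟩
  | seq _ _, hc => ⟨hc.1.mono h, hc.2.mono h⟩
  | ite _ _ _ _, hc => ⟨le_trans hc.1 h, hc.2.1.mono h, hc.2.2.mono h⟩
  | whl _ _, hc => ⟨le_trans hc.1 h, hc.2.mono h⟩

theorem exists_regLE : ∀ c : Cmd, ∃ n, c.RegLE n
  | push k _ => ⟨k, le_rfl⟩
  | pop k => ⟨k, le_rfl⟩
  | move k l => ⟨max k l, le_max_left _ _, le_max_right _ _⟩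
  | seq c d => by
    obtain ⟨n, hn⟩ := exists_regLE c
    obtain ⟨n', hn'⟩ := exists_regLE d
    exact ⟨max n n', hn.mono (le_max_left _ _), hn'.mono (le_max_right _ _)⟩
  | ite k _ c d => by
    obtain ⟨n, hn⟩ := exists_regLE c
    obtain ⟨n', hn'⟩ := exists_regLE d
    exact ⟨max k (max n n'), le_max_left _ _, hn.mono (by simp), hn'.mono (by simp)⟩
  | whl k c => by
    obtain ⟨n, hn⟩ := exists_regLE c
    exact ⟨max k n, le_max_left _ _, hn.mono (le_max_right _ _)⟩

/-- The labels of the machine code of a program. -/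
def Lab : Cmd → Type
  | push _ _ => Unit
  | pop _ => Unit
  | move _ _ => Unit
  | seq c d => Lab c ⊕ Lab d
  | ite _ _ c d => Option (Lab c ⊕ Lab d)
  | whl _ c => Option (Lab c)

instance finite_lab : ∀ c : Cmd, Finite (Lab c)
  | push _ _ => inferInstanceAs (Finite Unit)
  | pop _ => inferInstanceAs (Finite Unit)
  | move _ _ => inferInstanceAs (Finite Unit)
  | seq c d => by
    have := finite_lab c
    have := finite_lab d
    exact inferInstanceAs (Finite (Lab c ⊕ Lab d))
  | ite _ _ c d => by
    have := finite_lab c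
    have := finite_lab d
    exact inferInstanceAs (Finite (Option (Lab c ⊕ Lab d)))
  | whl _ c => by
    have := finite_lab c
    exact inferInstanceAs (Finite (Option (Lab c)))

/-- The label at which the machine code of a program starts. -/
def entry : ∀ c : Cmd, Lab c
  | push _ _ => ()
  | pop _ => ()
  | move _ _ => ()
  | seq c _ => Sum.inl (entry c)
  | ite _ _ _ _ => none
  | whl _ _ => none

/-- The stacks of the machine: one for the output bit, and the registers `0, …, n`. -/
abbrev StackAlphabet (n : ℕ) : Option (Fin (n + 1)) → Type
  | none => Bool
  | some _ => Symbol

/-- The stack of register `k`. -/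
abbrev reg (n k : ℕ) : Option (Fin (n + 1)) := some (Fin.ofNat (n + 1) k)

/-- The machine's stacks for a store: the output stack is empty. -/
def toStk (n : ℕ) (s : Store) : ∀ o, List (StackAlphabet n o)
  | none => []
  | some j => s j

/-- Machine statements with one symbol (or nothing) as internal state. -/
abbrev MStmt (n : ℕ) (Λ : Type) := TM2.Stmt (StackAlphabet n) Λ (Option Symbol)

/-- The machine code of a program; `emb` embeds its labels into those of the whole machine, and
control leaves the code towards `exit`. -/
def code (n : ℕ) {Λ : Type} : ∀ c : Cmd, (Lab c → Λ) → Λ → Lab c → MStmt n Λ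
  | push k a, _, exit, _ => .push (reg n k) (fun _ => a) (.goto fun _ => exit)
  | pop k, _, exit, _ => .pop (reg n k) (fun v _ => v) (.goto fun _ => exit)
  | move k l, _, exit, _ => .pop (reg n k) (fun _ o => o)
      (.branch (fun v => v.isSome)
        (.push (reg n l) (fun v => v.getD Symbol.endRow) (.goto fun _ => exit))
        (.goto fun _ => exit))
  | seq c _, emb, _, .inl l => code n c (fun l => emb (.inl l)) (emb (.inr (entry _))) l
  | seq _ d, emb, exit, .inr l => code n d (fun l => emb (.inr l)) exit l
  | ite k p c d, emb, _, none => .peek (reg n k) (fun _ o => o)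
      (.branch p (.goto fun _ => emb (some (.inl (entry c))))
        (.goto fun _ => emb (some (.inr (entry d)))))
  | ite _ _ c _, emb, exit, some (.inl l) => code n c (fun l => emb (some (.inl l))) exit l
  | ite _ _ _ d, emb, exit, some (.inr l) => code n d (fun l => emb (some (.inr l))) exit l
  | whl k c, emb, exit, none => .peek (reg n k) (fun _ o => o)
      (.branch (fun v => v.isSome) (.goto fun _ => emb (some (entry c))) (.goto fun _ => exit))
  | whl _ c, emb, _, some l => code n c (fun l => emb (some l)) (emb none) l

/-- `t` steps of the machine `M` lead from the configuration `a` to `b`. -/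
def Reach {n : ℕ} {Λ : Type} (M : Λ → MStmt n Λ) (t : ℕ)
    (a b : TM2.Cfg (StackAlphabet n) Λ (Option Symbol)) : Prop :=
  (flip bind (TM2.step M))^[t] (some a) = some b

theorem Reach.trans {n : ℕ} {Λ : Type} {M : Λ → MStmt n Λ} {t t' : ℕ} {a b c}
    (h : Reach M t a b) (h' : Reach M t' b c) : Reach M (t + t') a c := by
  have h1 := iterate_add_apply (flip bind (TM2.step M)) t' t (some a)
  exact (congrFun (congrArg _ (Nat.add_comm t t')) _).trans (h1.trans ((congrArg _ h).trans h'))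

theorem reach_one {n : ℕ} {Λ : Type} {M : Λ → MStmt n Λ} {l : Λ} {v S q b} (hq : M l = q)
    (h : TM2.stepAux q v S = b) : Reach M 1 ⟨some l, v, S⟩ b := by
  subst hq h
  rfl

theorem toStk_update {n k : ℕ} (hk : k ≤ n) (s : Store) (x : List Symbol) :
    update (toStk n s) (reg n k) x = toStk n (update s k x) := by
  funext o
  cases o with
  | none => rfl
  | some j =>
    by_cases h : (j : ℕ) = k
    · have : j = Fin.ofNat (n + 1) k := by
        ext; simp [h, Nat.mod_eq_of_lt (Nat.lt_succ_of_le hk)]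
      subst this
      simp only [update_self]
      simp only [toStk]
      rw [h, update_self]
    · have h2 : (some j : Option (Fin (n + 1))) ≠ reg n k := by
        intro h3
        apply h
        simp only [reg, Option.some.injEq] at h3
        rw [h3]
        simp [Nat.mod_eq_of_lt (Nat.lt_succ_of_le hk)]
      rw [update_of_ne h2]
      simp only [toStk]
      rw [update_of_ne h]

theorem toStk_reg {n k : ℕ} (hk : k ≤ n) (s : Store) : toStk n s (reg n k) = s k := by
  simp [toStk, Nat.mod_eq_of_lt (Nat.lt_succ_of_le hk)]

/-- The machine code simulates the program step by step. -/
theorem Exec.reach {n : ℕ} {Λ : Type} {M : Λ → MStmt n Λ} {c : Cmd} {s s' : Store} {t : ℕ}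
    (h : Exec c s s' t) : ∀ (emb : Lab c → Λ) (exit : Λ), c.RegLE n →
      (∀ l, M (emb l) = code n c emb exit l) → ∀ v, ∃ v',
        Reach M t ⟨some (emb (entry c)), v, toStk n s⟩ ⟨some exit, v', toStk n s'⟩ := by
  induction h with
  | push k a s =>
    intro emb exit hn hM v
    refine ⟨v, reach_one (hM _) ?_⟩
    simp only [code, TM2.stepAux]
    rw [toStk_reg hn, toStk_update hn]
  | pop k s =>
    intro emb exit hn hM v
    refine ⟨v, reach_one (hM _) ?_⟩
    simp only [code, TM2.stepAux]
    rw [toStk_reg hn, toStk_update hn]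
  | move k l s =>
    intro emb exit hn hM v
    refine ⟨(s k).head?, reach_one (hM _) ?_⟩
    simp only [code, TM2.stepAux]
    rw [toStk_reg hn.1, toStk_update hn.1, toStk_reg hn.2, toStk_update hn.2]
    unfold moveStore
    cases h : s k with
    | nil =>
      have : update s k [] = s := by rw [← h, update_eq_self]
      simp [this]
    | cons a t => simp
  | seq _ _ ih1 ih2 =>
    intro emb exit hn hM v
    obtain ⟨v1, h1⟩ := ih1 (fun l => emb (.inl l)) (emb (.inr (entry _))) hn.1
      (fun l => hM (.inl l)) v
    obtain ⟨v2, h2⟩ := ih2 (fun l => emb (.inr l)) exit hn.2 (fun l => hM (.inr l)) v1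
    exact ⟨v2, h1.trans h2⟩
  | ite_true hp _ ih =>
    intro emb exit hn hM v
    obtain ⟨v1, h1⟩ := ih (fun l => emb (some (.inl l))) exit hn.2.1
      (fun l => hM (some (.inl l))) _
    refine ⟨v1, (reach_one (hM _) ?_).trans h1⟩
    simp only [code, entry, TM2.stepAux]
    rw [toStk_reg hn.1, hp]
    rfl
  | ite_false hp _ ih =>
    intro emb exit hn hM v
    obtain ⟨v1, h1⟩ := ih (fun l => emb (some (.inr l))) exit hn.2.2
      (fun l => hM (some (.inr l))) _
    refine ⟨v1, (reach_one (hM _) ?_).trans h1⟩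
    simp only [code, entry, TM2.stepAux]
    rw [toStk_reg hn.1, hp]
    rfl
  | whl_nil hk =>
    intro emb exit hn hM v
    refine ⟨none, reach_one (hM _) ?_⟩
    simp only [code, entry, TM2.stepAux]
    rw [toStk_reg hn.1, hk]
    rfl
  | @whl_cons k c s s' s'' t t' hk _ _ ih1 ih2 =>
    intro emb exit hn hM v
    obtain ⟨v1, h1⟩ := ih1 (fun l => emb (some l)) (emb none) hn.2
      (fun l => hM (some l)) (s k).head?
    obtain ⟨v2, h2⟩ := ih2 emb exit hn hM v1
    refine ⟨v2, ((reach_one (hM _) ?_).trans h1).trans h2⟩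
    simp only [code, entry, TM2.stepAux]
    rw [toStk_reg hn.1]
    have : ((s k).head?).isSome = true := by
      cases h : s k with
      | nil => exact absurd h hk
      | cons => rfl
    rw [this]
    rfl

/-- The last statement of the machine: it turns register `1` (empty or a single symbol) into the
output bit, and resets the internal state. -/
def finalStmt (n : ℕ) (Λ : Type) : MStmt n Λ :=
  .pop (reg n 1) (fun _ o => o) (.branch (fun v => v.isSome)
    (.push none (fun _ => true) (.load (fun _ => none) .halt))
    (.push none (fun _ => false) (.load (fun _ => none) .halt)))

theorem stepAux_finalStmt {n : ℕ} (hn : 1 ≤ n) (Λ : Type) (v : Option Symbol) (b : Bool) :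
    TM2.stepAux (finalStmt n Λ) v
      (toStk n (update (fun _ => []) 1 (if b then [Symbol.bit true] else []))) =
    ⟨none, none, update (fun _ => []) none [b]⟩ := by
  have h : ∀ s : Store, update s 1 [] = fun k => if k = 1 then [] else s k := by
    intro s; funext k; simp [update_apply]
  have h0 : toStk n (fun _ => []) = fun _ => [] := by
    funext o; cases o <;> rfl
  simp only [finalStmt, TM2.stepAux]
  rw [toStk_reg hn, toStk_update hn]
  cases b <;> simp [h0, toStk]

/-- The whole machine: the code of `c`, and then the final statement. -/
noncomputable def machine (c : Cmd) (n : ℕ) : FinTM2 :=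
  { K := Option (Fin (n + 1))
    k₀ := reg n 0
    k₁ := none
    Γ := StackAlphabet n
    Λ := Option (Lab c)
    main := some (entry c)
    ΛFin := Fintype.ofFinite _
    σ := Option Symbol
    initialState := none
    Γk₀Fin := inferInstanceAs (Fintype Symbol)
    m := fun l => match l with
      | some l => code n c some none l
      | none => finalStmt n _ }

end Cmd

open Classical in
/-- A program that, started with the input word in register `0`, leaves the answer in register `1`
and all other registers empty, within polynomial time, decides its problem in polynomial time. -/
theorem polyTimeDecidable_of_exec {α : Type} {enc : α → List Symbol} {Q : α → Prop} (c : Cmd)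
    (p : Polynomial ℕ)
    (h : ∀ a, ∃ t ≤ p.eval (enc a).length, Cmd.Exec c (update (fun _ => []) 0 (enc a))
      (update (fun _ => []) 1 (if Q a then [Symbol.bit true] else [])) t) :
    PolyTimeDecidable enc Q := by
  obtain ⟨n, hn⟩ := c.exists_regLE
  have hn : c.RegLE (n + 1) := hn.mono (Nat.le_succ n)
  have key : ∀ a, Nonempty (TM2OutputsInTime (c.machine (n + 1))
      (List.map (Equiv.refl Symbol).invFun (enc a))
      (some (List.map (Equiv.refl Bool).invFun (Computability.encodeBool (decide (Q a)))))
      ((p + 1).eval (enc a).length)) := by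
    intro a
    obtain ⟨t, ht, he⟩ := h a
    obtain ⟨v, hv⟩ := he.reach (M := (c.machine (n + 1)).m) some none hn (fun _ => rfl) none
    have hinit : initList (c.machine (n + 1)) (List.map (Equiv.refl Symbol).invFun (enc a)) =
        ⟨some (some (Cmd.entry c)), none,
          Cmd.toStk (n + 1) (update (fun _ => []) 0 (enc a))⟩ := by
      unfold initList
      congr 1
      funext o
      cases o with
      | none => exact dif_neg (by simp [Cmd.machine])
      | some j =>
        by_cases hj : j = 0
        · subst hj
          refine (dif_pos rfl).trans ?_
          exact List.map_id _
        · refine (dif_neg ?_).trans ?_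
          · simpa [Cmd.machine] using hj
          · have : (j : ℕ) ≠ 0 := fun h => hj (Fin.ext h)
            simp [Cmd.toStk, this]
            rfl
    have hhalt : TM2.stepAux ((c.machine (n + 1)).m none) v (Cmd.toStk (n + 1)
        (update (fun _ => []) 1 (if Q a then [Symbol.bit true] else []))) =
        haltList (c.machine (n + 1))
          (List.map (Equiv.refl Bool).invFun (Computability.encodeBool (decide (Q a)))) := by
      have h1 := Cmd.stepAux_finalStmt (n := n + 1) (by omega) (Option (Cmd.Lab c)) v (decide (Q a))
      simp only [decide_eq_true_eq] at h1
      refine h1.trans ?_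
      unfold haltList
      congr 1
      funext o
      cases o with
      | none =>
        symm
        refine (dif_pos rfl).trans ?_
        exact (update_self (β := fun o => List (Cmd.StackAlphabet (n + 1) o)) none _ _).symm
      | some j =>
        symm
        refine (dif_neg (Option.some_ne_none j)).trans ?_
        exact (update_of_ne (β := fun o => List (Cmd.StackAlphabet (n + 1) o))
          (Option.some_ne_none j) [decide (Q a)] (fun _ => [])).symm
    exact ⟨⟨t + 1, (congrArg _ (congrArg some hinit)).trans (hv.trans (Cmd.reach_one rfl hhalt))⟩,
      by simpa using ht⟩
  exact ⟨⟨⟨c.machine (n + 1), Equiv.refl _, Equiv.refl _⟩, p + 1, fun a => (key a).some⟩⟩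

namespace Cmd

/-- `c` takes `s` to `s'` in at most `t` steps. -/
def ExecLE (c : Cmd) (s s' : Store) (t : ℕ) : Prop := ∃ t' ≤ t, Exec c s s' t'

theorem ExecLE.mono {c : Cmd} {s s' : Store} {t t' : ℕ} (h : ExecLE c s s' t) (ht : t ≤ t') :
    ExecLE c s s' t' := by
  obtain ⟨u, hu, h⟩ := h
  exact ⟨u, hu.trans ht, h⟩

theorem ExecLE.congr {c : Cmd} {s s' s'' : Store} {t : ℕ} (h : ExecLE c s s' t) (hs : s' = s'') :
    ExecLE c s s'' t := hs ▸ h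

theorem ExecLE.seq {c d : Cmd} {s s' s'' : Store} {t t' : ℕ} (h : ExecLE c s s' t)
    (h' : ExecLE d s' s'' t') : ExecLE (seq c d) s s'' (t + t') := by
  obtain ⟨u, hu, h⟩ := h
  obtain ⟨u', hu', h'⟩ := h'
  exact ⟨u + u', add_le_add hu hu', .seq h h'⟩

theorem execLE_push (k : ℕ) (a : Symbol) (s : Store) :
    ExecLE (push k a) s (update s k (a :: s k)) 1 := ⟨1, le_rfl, .push k a s⟩

theorem execLE_pop (k : ℕ) (s : Store) : ExecLE (pop k) s (update s k (s k).tail) 1 :=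
  ⟨1, le_rfl, .pop k s⟩

theorem execLE_move_cons {k l : ℕ} (hkl : l ≠ k) {s : Store} {a : Symbol} {x : List Symbol}
    (hs : s k = a :: x) : ExecLE (move k l) s (update (update s k x) l (a :: s l)) 1 := by
  refine ⟨1, le_rfl, ?_⟩
  have := Exec.move k l s
  simpa [moveStore, hs, hkl] using this

theorem execLE_move_nil {k l : ℕ} {s : Store} (hs : s k = []) : ExecLE (move k l) s s 1 := by
  refine ⟨1, le_rfl, ?_⟩
  have := Exec.move k l s
  simpa [moveStore, hs] using this

theorem execLE_ite {k : ℕ} {p : Option Symbol → Bool} {c d : Cmd} {s s' : Store} {t : ℕ}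
    (h1 : p (s k).head? = true → ExecLE c s s' t)
    (h2 : p (s k).head? = false → ExecLE d s s' t) : ExecLE (ite k p c d) s s' (1 + t) := by
  cases hp : p (s k).head? with
  | true =>
    obtain ⟨u, hu, h⟩ := h1 hp
    exact ⟨1 + u, by omega, .ite_true hp h⟩
  | false =>
    obtain ⟨u, hu, h⟩ := h2 hp
    exact ⟨1 + u, by omega, .ite_false hp h⟩

/-- A loop that runs exactly `n` times passes through a sequence `σ 0, …, σ n` of stores. -/
theorem execLE_whl {k : ℕ} {c : Cmd} {T : ℕ} {s s' : Store} (n : ℕ) (σ : ℕ → Store)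
    (hs : s = σ 0) (hs' : σ n = s') (h1 : ∀ i < n, σ i k ≠ []) (h0 : σ n k = [])
    (h2 : ∀ i < n, ExecLE c (σ i) (σ (i + 1)) T) : ExecLE (whl k c) s s' (n * (T + 1) + 1) := by
  induction n generalizing σ s with
  | zero =>
    subst hs hs'
    exact ⟨1, by omega, .whl_nil h0⟩
  | succ n ih =>
    obtain ⟨t, ht, h⟩ := ih (fun i => σ (i + 1)) rfl hs' (fun i hi => h1 _ (by omega)) h0
      (fun i hi => h2 _ (by omega))
    obtain ⟨u, hu, h'⟩ := h2 0 (by omega)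
    subst hs
    exact ⟨1 + u + t, by nlinarith, .whl_cons (h1 0 (by omega)) h' h⟩

theorem _root_.List.reverse_take_add_one {α : Type*} {l : List α} {i : ℕ} (h : i < l.length) :
    (l.take (i + 1)).reverse = l[i] :: (l.take i).reverse := by
  rw [List.take_add_one, List.getElem?_eq_getElem h]
  simp

/-- Empty the stack `k`. -/
def clear (k : ℕ) : Cmd := whl k (pop k)

theorem execLE_clear (k : ℕ) (s : Store) :
    ExecLE (clear k) s (update s k []) ((s k).length * 2 + 1) :=
  execLE_whl (s k).length (fun i => update s k ((s k).drop i)) (by simp) (by simp)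
    (fun i hi => by simpa using hi) (by simp) (fun i hi => (execLE_pop k _).congr (by simp))

/-- Move the content of the stack `k` to the stack `l`, which reverses it. -/
def moveAll (k l : ℕ) : Cmd := whl k (move k l)

theorem execLE_moveAll {k l : ℕ} (hkl : l ≠ k) (s : Store) :
    ExecLE (moveAll k l) s (update (update s k []) l ((s k).reverse ++ s l))
      ((s k).length * 2 + 1) :=
  execLE_whl (s k).length
    (fun i => update (update s k ((s k).drop i)) l (((s k).take i).reverse ++ s l))
    (by simp) (by simp)
    (fun i hi => by simpa [update_of_ne hkl.symm] using hi) (by simp [update_of_ne hkl.symm])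
    (fun i hi => (execLE_move_cons hkl (a := (s k)[i]) (x := (s k).drop (i + 1))
      (by simp [update_of_ne hkl.symm])).congr (by
        funext j
        simp only [update_apply]
        split_ifs <;> simp [List.reverse_take_add_one hi]))

end Cmd

/-! ### A language of polynomial-time expressions -/

/-- The letter `1` of unary numbers. -/
abbrev tt : Symbol := Symbol.bit true

/-- Environments of expressions, as de Bruijn-indexed stacks. A variable stands for a table of
symbols as well as for a natural number, its length. -/
abbrev Env := ℕ → List Symbol

/-- The environment with a new variable `0`. -/
def consEnv {β : Type} (l : β) (ρ : ℕ → β) : ℕ → β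
  | 0 => l
  | n + 1 => ρ n

@[simp] theorem consEnv_zero {β : Type} (l : β) (ρ : ℕ → β) : consEnv l ρ 0 = l := rfl

@[simp] theorem consEnv_succ {β : Type} (l : β) (ρ : ℕ → β) (n : ℕ) :
    consEnv l ρ (n + 1) = ρ n := rfl

theorem forall_consEnv {β : Type} {l : β} {ρ : ℕ → β} {p : ℕ → β → Prop} (h0 : p 0 l)
    (h1 : ∀ n, p (n + 1) (ρ n)) : ∀ n, p n (consEnv l ρ n)
  | 0 => h0
  | n + 1 => h1 n

/-- The number that stands for a symbol. -/
def Symbol.toNat : Symbol → ℕ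
  | bit false => 0
  | bit true => 1
  | endRow => 2
  | endBlock => 3

theorem Symbol.toNat_le (a : Symbol) : a.toNat ≤ 3 := by
  rcases a with (_ | _) | _ | _ <;> simp [Symbol.toNat]

/-- Expressions for natural numbers. `get x e` is the number of the entry `e` of variable `x`,
and `0` beyond its end; subtraction is truncated. `sum e b` is a sum over all numbers below `e`;
the number is variable `0` of `b`. `iter c l st b` is the value of `b` when its variable `0` is the
table of bits that results from the empty table by `c` rounds: each makes a new table of length
`l`, with the entries given by `st`, which has the index as variable `0` and the old table as
variable `1`. All these operations preserve polynomial bounds for values and for time. -/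
inductive Expr where
  | len (x : ℕ)
  | get (x : ℕ) (e : Expr)
  | one
  | add (e f : Expr)
  | sub (e f : Expr)
  | sum (e b : Expr)
  | iter (c l st b : Expr)

/-- One round of the iteration: the table with the entries `f T 0, …, f T (n - 1)`. -/
def tableStep (n : ℕ) (f : List Symbol → ℕ → Bool) (T : List Symbol) : List Symbol :=
  (List.range n).map fun i => Symbol.bit (f T i)

namespace Expr

/-- The value of an expression. -/
def eval : Expr → Env → ℕ
  | len x, ρ => (ρ x).length
  | get x e, ρ => ((ρ x)[eval e ρ]?.map Symbol.toNat).getD 0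
  | one, _ => 1
  | add e f, ρ => eval e ρ + eval f ρ
  | sub e f, ρ => eval e ρ - eval f ρ
  | sum e b, ρ => ∑ i ∈ Finset.range (eval e ρ), eval b (consEnv (List.replicate i tt) ρ)
  | iter c l st b, ρ => eval b (consEnv ((tableStep (eval l ρ) fun T i =>
      decide (eval st (consEnv (List.replicate i tt) (consEnv T ρ)) ≠ 0))^[eval c ρ] []) ρ)

open Cmd

/-- The instruction that appends the number of the top symbol of `k`, in unary, to `out`;
`b` is an empty stack. -/
def emit (k b out : ℕ) : Cmd :=
  ite k (fun o => o = some tt) (push out tt)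
    (ite k (fun o => o = some .endRow) (seq (push out tt) (push out tt))
      (ite k (fun o => o = some .endBlock) (seq (push out tt) (seq (push out tt) (push out tt)))
        (pop b)))

/-- The program that replaces the table in register `b + 1` by a new one; `cl` appends its length
to register `b + 3`, and `cst` appends to register `b + 5` the entry at the index in `b + 4`. -/
def tableCmd (cl cst : Cmd) (b : ℕ) : Cmd :=
  seq cl <|
  seq (whl (b + 3) <| seq (pop (b + 3)) <|
    seq cst <|
    seq (ite (b + 5) Option.isSome (push (b + 2) tt) (push (b + 2) (.bit false))) <|
    seq (clear (b + 5)) (push (b + 4) tt)) <|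
  seq (clear (b + 4)) <| seq (clear (b + 1)) (moveAll (b + 2) (b + 1))

/-- The program that appends the value of an expression, in unary, to the stack `out`. Variable
`x` is held in register `r x`; the registers from `b` on are empty, and they are emptied again. -/
def compile : Expr → (ℕ → ℕ) → ℕ → ℕ → Cmd
  | len x, r, b, out =>
    seq (whl (r x) (seq (move (r x) b) (push out tt))) (moveAll b (r x))
  | get x e, r, b, out =>
    seq (compile e r (b + 1) b) <|
    seq (whl b (seq (pop b) (move (r x) (b + 1)))) <|
    seq (emit (r x) b out) (moveAll (b + 1) (r x))
  | one, _, _, out => push out tt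
  | add e f, r, b, out => seq (compile e r b out) (compile f r b out)
  | sub e f, r, b, out =>
    seq (compile e r (b + 1) b) <|
    seq (compile f r (b + 2) (b + 1)) <|
    seq (whl (b + 1) (seq (pop (b + 1)) (pop b))) (moveAll b out)
  | sum e f, r, b, out =>
    seq (compile e r (b + 1) b) <|
    seq (whl b (seq (pop b) (seq (compile f (consEnv (b + 1) r) (b + 2) out) (push (b + 1) tt))))
      (clear (b + 1))
  | iter c l st f, r, b, out =>
    seq (compile c r (b + 1) b) <|
    seq (whl b <| seq (pop b) <| tableCmd (compile l r (b + 4) (b + 3))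
      (compile st (consEnv (b + 4) (consEnv (b + 1) r)) (b + 6) (b + 5)) b) <|
    seq (compile f (consEnv (b + 1) r) (b + 2) out) (clear (b + 1))

theorem length_iterate_tableStep_le (n c : ℕ) (f : List Symbol → ℕ → Bool) :
    ((tableStep n f)^[c] []).length ≤ n := by
  cases c with
  | zero => simp
  | succ c => simp [iterate_succ_apply', tableStep]

open Polynomial in
/-- Values are polynomially bounded. -/
theorem exists_eval_le : ∀ e : Expr, ∃ q : Polynomial ℕ, ∀ (ρ : Env) (S : ℕ),
    (∀ i, (ρ i).length ≤ S) → e.eval ρ ≤ q.eval S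
  | len x => ⟨X, fun ρ S h => by simpa [Expr.eval] using h x⟩
  | get x e => ⟨3, fun ρ S h => by
      simp only [Expr.eval]
      cases (ρ x)[e.eval ρ]? with
      | none => simp
      | some a => simpa using Symbol.toNat_le a⟩
  | one => ⟨1, fun ρ S h => by simp [Expr.eval]⟩
  | add e f => by
    obtain ⟨p, hp⟩ := exists_eval_le e
    obtain ⟨q, hq⟩ := exists_eval_le f
    exact ⟨p + q, fun ρ S h => by simpa [Expr.eval] using add_le_add (hp ρ S h) (hq ρ S h)⟩
  | sub e f => by
    obtain ⟨p, hp⟩ := exists_eval_le e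
    exact ⟨p, fun ρ S h => (Nat.sub_le _ _).trans (hp ρ S h)⟩
  | sum e f => by
    obtain ⟨p, hp⟩ := exists_eval_le e
    obtain ⟨q, hq⟩ := exists_eval_le f
    refine ⟨p * q.comp (X + p), fun ρ S h => ?_⟩
    have h1 := hp ρ S h
    simp only [Expr.eval, eval_mul, eval_comp, eval_add, eval_X]
    refine (Finset.sum_le_card_nsmul _ _ (q.eval (S + p.eval S)) fun i hi => ?_).trans ?_
    · refine hq _ _ (forall_consEnv (p := fun _ (l : List Symbol) => l.length ≤ _) ?_ fun n => ?_)
      · have := Finset.mem_range.1 hi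
        simp
        omega
      · exact (h n).trans (by omega)
    · simpa using Nat.mul_le_mul_right _ h1
  | iter c l st f => by
    obtain ⟨p, hp⟩ := exists_eval_le l
    obtain ⟨q, hq⟩ := exists_eval_le f
    refine ⟨q.comp (X + p), fun ρ S h => ?_⟩
    have h1 := hp ρ S h
    simp only [Expr.eval, eval_comp, eval_add, eval_X]
    refine hq _ _ (forall_consEnv (p := fun _ (l : List Symbol) => l.length ≤ _) ?_ fun n => ?_)
    · exact (length_iterate_tableStep_le _ _ _).trans (by omega)
    · exact (h n).trans (by omega)

/-- The correctness statement of `compile`, with time bound `p`. -/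
def CompileSpec (e : Expr) (p : Polynomial ℕ) : Prop :=
  ∀ (r : ℕ → ℕ) (b out : ℕ) (s : Store) (ρ : Env) (S : ℕ), out < b → (∀ i, r i < b) →
    (∀ i, r i ≠ out) → (∀ k, b ≤ k → s k = []) → (∀ i, s (r i) = ρ i) →
    (∀ i, (ρ i).length ≤ S) →
    ExecLE (compile e r b out) s (update s out (List.replicate (e.eval ρ) tt ++ s out)) (p.eval S)

theorem compileSpec_len (x : ℕ) : CompileSpec (len x) (5 * Polynomial.X + 2) := by
  intro r b out s ρ S hout hr hro hb hs hS
  have hx := hr x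
  have hxo := hro x
  have hbx := hb b le_rfl
  obtain ⟨l, hl⟩ : ∃ l, s (r x) = l := ⟨_, rfl⟩
  have hlρ : ρ x = l := by rw [← hl, hs]
  have hlS : l.length ≤ S := by rw [← hlρ]; exact hS x
  have h1 : ExecLE (whl (r x) (seq (move (r x) b) (push out tt))) s
      (update (update (update s (r x) []) b l.reverse) out (List.replicate l.length tt ++ s out))
      (l.length * (2 + 1) + 1) := execLE_whl l.length
    (fun i => update (update (update s (r x) (l.drop i)) b (l.take i).reverse) out
      (List.replicate i tt ++ s out)) (by
        funext j
        simp only [update_apply]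
        split_ifs <;> simp_all) (by simp)
    (fun i hi => by simpa [hxo, hx.ne] using hi) (by simp [hxo, hx.ne])
    (fun i hi => by
      refine ((execLE_move_cons (a := l[i]) (x := l.drop (i + 1)) hx.ne'
        ?_).seq (execLE_push out tt _)).congr ?_
      · simp [hxo, hx.ne]
      · funext j
        simp only [update_apply]
        split_ifs <;> first | omega | simp [List.reverse_take_add_one hi, List.replicate_succ])
  refine ((h1.seq (execLE_moveAll hx.ne _)).congr ?_).mono ?_
  · funext j
    simp only [update_apply, Expr.eval, hlρ]
    split_ifs <;> first | omega | simp_all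
  · simp [hout.ne']
    omega

theorem replicate_append_replicate_append {α : Type*} (m n : ℕ) (a : α) (l : List α) :
    List.replicate m a ++ (List.replicate n a ++ l) = List.replicate (m + n) a ++ l := by
  rw [← List.append_assoc, List.replicate_append_replicate]

theorem compileSpec_one : CompileSpec one 1 := by
  intro r b out s ρ S hout hr hro hb hs hS
  simpa [Expr.eval, compile] using execLE_push out tt s

theorem compileSpec_add {e f : Expr} {p q : Polynomial ℕ} (he : CompileSpec e p)
    (hf : CompileSpec f q) : CompileSpec (add e f) (p + q) := by
  intro r b out s ρ S hout hr hro hb hs hS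
  refine (((he r b out s ρ S hout hr hro hb hs hS).seq (hf r b out _ ρ S hout hr hro
    (fun k hk => ?_) (fun i => ?_) hS)).congr ?_).mono (by simp)
  · rw [update_of_ne (by omega), hb k hk]
  · rw [update_of_ne (hro i), hs]
  · simp [Expr.eval, Nat.add_comm (e.eval ρ), replicate_append_replicate_append]

theorem store_ne {s : Store} {k l : ℕ} {x : List Symbol} (h : l ≠ k) : update s k x l = s l :=
  update_of_ne h _ _

/-- The specification of `compile` for an empty output register just below the free ones. -/
theorem CompileSpec.run {e : Expr} {p : Polynomial ℕ} (he : CompileSpec e p) {r : ℕ → ℕ}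
    {b : ℕ} {s : Store} {ρ : Env} {S : ℕ} (hr : ∀ i, r i < b) (hb : ∀ k, b ≤ k → s k = [])
    (hs : ∀ i, s (r i) = ρ i) (hS : ∀ i, (ρ i).length ≤ S) :
    ExecLE (compile e r (b + 1) b) s (update s b (List.replicate (e.eval ρ) tt)) (p.eval S) := by
  have h := he r (b + 1) b s ρ S (by omega) (fun i => (hr i).trans (by omega))
    (fun i => (hr i).ne) (fun k hk => hb k (by omega)) hs hS
  rwa [hb b le_rfl, List.append_nil] at h

theorem compileSpec_sub {e f : Expr} {p q u v : Polynomial ℕ} (he : CompileSpec e p)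
    (hf : CompileSpec f q)
    (hu : ∀ (ρ : Env) (S : ℕ), (∀ i, (ρ i).length ≤ S) → e.eval ρ ≤ u.eval S)
    (hv : ∀ (ρ : Env) (S : ℕ), (∀ i, (ρ i).length ≤ S) → f.eval ρ ≤ v.eval S) :
    CompileSpec (sub e f) (p + q + 3 * v + 2 * u + 2) := by
  intro r b out s ρ S hout hr hro hb hs hS
  have hu := hu ρ S hS
  have hv := hv ρ S hS
  have h1 := he.run hr hb hs hS
  have h2 := hf.run (r := r) (b := b + 1) (s := update s b (List.replicate (e.eval ρ) tt))
    (fun i => (hr i).trans (by omega))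
    (fun k hk => by rw [store_ne (by omega), hb k (by omega)])
    (fun i => by rw [store_ne (hr i).ne, hs i]) hS
  have h3 : ExecLE (whl (b + 1) (seq (pop (b + 1)) (pop b)))
      (update (update s b (List.replicate (e.eval ρ) tt)) (b + 1) (List.replicate (f.eval ρ) tt))
      (update s b (List.replicate (e.eval ρ - f.eval ρ) tt)) (f.eval ρ * (2 + 1) + 1) :=
    execLE_whl (f.eval ρ) (fun i => update (update s b (List.replicate (e.eval ρ - i) tt)) (b + 1)
        (List.replicate (f.eval ρ - i) tt)) (by simp)
      (by
        funext j
        simp only [update_apply]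
        split_ifs <;> simp_all)
      (fun i hi => by simp; omega) (by simp)
      (fun i hi => ((execLE_pop _ _).seq (execLE_pop _ _)).congr (by
        funext j
        simp only [update_apply]
        split_ifs <;> first | omega | simp_all [Nat.sub_sub]))
  refine ((h1.seq (h2.seq (h3.seq (execLE_moveAll hout.ne _)))).congr ?_).mono ?_
  · have := hb b le_rfl
    funext j
    simp only [update_apply, Expr.eval]
    split_ifs <;> first | omega | simp_all
  · simp
    omega

theorem compileSpec_sum {e f : Expr} {p q u : Polynomial ℕ} (he : CompileSpec e p)
    (hf : CompileSpec f q)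
    (hu : ∀ (ρ : Env) (S : ℕ), (∀ i, (ρ i).length ≤ S) → e.eval ρ ≤ u.eval S) :
    CompileSpec (sum e f) (p + u * (q.comp (Polynomial.X + u) + 3) + 2 * u + 2) := by
  intro r b out s ρ S hout hr hro hb hs hS
  have hu := hu ρ S hS
  have h1 := he.run hr hb hs hS
  set n := e.eval ρ with hn
  have hb0 := hb b le_rfl
  have hb1 := hb (b + 1) (by omega)
  have h2 : ExecLE (whl b (seq (pop b) (seq (compile f (consEnv (b + 1) r) (b + 2) out)
      (push (b + 1) tt)))) (update s b (List.replicate n tt))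
      (update (update s (b + 1) (List.replicate n tt)) out
        (List.replicate ((sum e f).eval ρ) tt ++ s out))
      (n * ((1 + (q.eval (S + u.eval S) + 1)) + 1) + 1) :=
    execLE_whl n (fun i => update (update (update s b (List.replicate (n - i) tt))
        (b + 1) (List.replicate i tt)) out
        (List.replicate (∑ j ∈ Finset.range i, f.eval (consEnv (List.replicate j tt) ρ)) tt
          ++ s out))
      (by
        funext j
        simp only [update_apply]
        split_ifs <;> first | omega | simp_all)
      (by
        funext j
        simp only [update_apply, Expr.eval]
        split_ifs <;> first | omega | simp_all)
      (fun i hi => by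
        rw [store_ne hout.ne', store_ne (by omega), update_self]
        simp
        omega)
      (by rw [store_ne hout.ne', store_ne (by omega), update_self]; simp)
      (fun i hi => by
        refine ((execLE_pop _ _).seq ((hf (consEnv (b + 1) r) (b + 2) out _
          (consEnv (List.replicate i tt) ρ) _ (by omega)
          (forall_consEnv (p := fun _ (k : ℕ) => k < b + 2) (by omega)
            fun k => (hr k).trans (by omega))
          (forall_consEnv (p := fun _ (k : ℕ) => k ≠ out) (by omega) hro) ?_ ?_ ?_).seq
          (execLE_push _ _ _))).congr ?_
        · intro k hk
          simp only [update_apply]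
          split_ifs <;> first | omega | exact hb k (by omega)
        · rintro (_ | k)
          · simp only [consEnv_zero, update_apply]
            split_ifs <;> first | omega | rfl
          · have h3 := hr k
            have h4 := hro k
            simp only [consEnv_succ, update_apply]
            split_ifs <;> first | omega | exact hs k
        · refine forall_consEnv (p := fun _ (l : List Symbol) => l.length ≤ _) ?_ fun k => ?_
          · simp
            omega
          · exact (hS k).trans (by omega)
        · funext j
          simp only [update_apply, Finset.sum_range_succ]
          split_ifs <;> first | omega | simp_all [Nat.sub_sub, List.replicate_succ, Nat.add_comm,
            replicate_append_replicate_append])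
  refine ((h1.seq (h2.seq (execLE_clear _ _))).congr ?_).mono ?_
  · funext j
    simp only [update_apply]
    split_ifs <;> first | omega | simp_all
  · rw [store_ne (by omega), update_self]
    simp
    nlinarith

/-- Popping the empty stack `b` is the way in which `emit` does nothing. -/
theorem execLE_emit (k b out : ℕ) (s : Store) (hb : s b = []) :
    ExecLE (emit k b out) s
      (update s out (List.replicate (((s k).head?.map Symbol.toNat).getD 0) tt ++ s out)) 6 := by
  have hskip : ExecLE (pop b) s (update s out (List.replicate 0 tt ++ s out)) 1 := by
    refine (execLE_pop b s).congr ?_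
    rw [hb, List.tail_nil, ← hb]
    simp
  have h1 : ExecLE (push out tt) s (update s out (List.replicate 1 tt ++ s out)) 1 :=
    execLE_push _ _ _
  have h2 : ExecLE (seq (push out tt) (push out tt)) s
      (update s out (List.replicate 2 tt ++ s out)) 2 :=
    (h1.seq (execLE_push _ _ _)).congr (by simp [List.replicate_succ])
  have h3 : ExecLE (seq (push out tt) (seq (push out tt) (push out tt))) s
      (update s out (List.replicate 3 tt ++ s out)) 3 :=
    (h1.seq ((execLE_push _ _ _).seq (execLE_push _ _ _))).congr (by simp [List.replicate_succ])
  refine (execLE_ite (t := 5) (fun h => ?_) fun h => execLE_ite (t := 4) (fun h' => ?_)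
    fun h' => execLE_ite (t := 3) (fun h'' => ?_) fun h'' => ?_).mono (by omega)
  · rw [of_decide_eq_true h]
    exact h1.mono (by omega)
  · rw [of_decide_eq_true h']
    exact h2.mono (by omega)
  · rw [of_decide_eq_true h'']
    exact h3
  · refine (hskip.mono (by omega)).congr ?_
    congr 3
    have h := of_decide_eq_false h
    have h' := of_decide_eq_false h'
    have h'' := of_decide_eq_false h''
    cases hs : (s k).head? with
    | none => rfl
    | some a =>
      rw [hs] at h h' h''
      rcases a with (_ | _) | _ | _ <;> first | rfl | exact absurd rfl h | exact absurd rfl h' |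
        exact absurd rfl h''

theorem compileSpec_get (x : ℕ) {e : Expr} {p u : Polynomial ℕ} (he : CompileSpec e p)
    (hu : ∀ (ρ : Env) (S : ℕ), (∀ i, (ρ i).length ≤ S) → e.eval ρ ≤ u.eval S) :
    CompileSpec (get x e) (p + 3 * u + 2 * Polynomial.X + 8) := by
  intro r b out s ρ S hout hr hro hb hs hS
  have hu := hu ρ S hS
  have h1 := he.run hr hb hs hS
  have hx := hr x
  have hxo := hro x
  have hb0 := hb b le_rfl
  have hb1 := hb (b + 1) (by omega)
  obtain ⟨l, hl⟩ : ∃ l, s (r x) = l := ⟨_, rfl⟩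
  have hlρ : ρ x = l := by rw [← hl, hs]
  have hlS : l.length ≤ S := by rw [← hlρ]; exact hS x
  clear hS hs he hr hro hb
  obtain ⟨n, hn⟩ : ∃ n, e.eval ρ = n := ⟨_, rfl⟩
  rw [hn] at h1 hu
  have h2 : ExecLE (whl b (seq (pop b) (move (r x) (b + 1)))) (update s b (List.replicate n tt))
      (update (update s (r x) (l.drop n)) (b + 1) (l.take n).reverse) (n * (2 + 1) + 1) :=
    execLE_whl n (fun i => update (update (update s b (List.replicate (n - i) tt)) (r x) (l.drop i))
        (b + 1) (l.take i).reverse)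
      (by
        funext j
        simp only [update_apply]
        split_ifs <;> first | omega | simp_all)
      (by
        funext j
        simp only [update_apply]
        split_ifs <;> first | omega | simp_all)
      (fun i hi => by
        rw [store_ne (by omega), store_ne (by omega), update_self]
        simp
        omega)
      (by rw [store_ne (by omega), store_ne (by omega), update_self]; simp)
      (fun i hi => by
        by_cases hil : i < l.length
        · refine ((execLE_pop _ _).seq (execLE_move_cons (a := l[i]) (x := l.drop (i + 1))
            (by omega) ?_)).congr ?_
          · simp [hx.ne, hx.ne', (hx.trans (Nat.lt_succ_self b)).ne]
          · funext j
            simp only [update_apply]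
            split_ifs <;> first | omega | simp_all [List.reverse_take_add_one hil, Nat.sub_sub]
        · refine ((execLE_pop _ _).seq (execLE_move_nil ?_)).congr ?_
          · simp [update_apply, hx.ne, (hx.trans (Nat.lt_succ_self b)).ne]
            omega
          · have h1 : l.drop i = [] := by simp; omega
            have h2 : l.drop (i + 1) = [] := by simp; omega
            have h3 : l.take i = l := List.take_of_length_le (by omega)
            have h4 : l.take (i + 1) = l := List.take_of_length_le (by omega)
            rw [h1, h2, h3, h4]
            funext j
            simp only [update_apply]
            split_ifs <;> first | omega | simp_all [Nat.sub_sub])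
  refine ((h1.seq (h2.seq ((execLE_emit (r x) b out _ ?_).seq
    (execLE_moveAll (k := b + 1) (l := r x) (by omega) _)))).congr ?_).mono ?_
  · simp [hx.ne', hb0]
  · funext j
    have hlt : l.take n ++ l.drop n = l := List.take_append_drop n l
    simp only [update_apply, Expr.eval, hlρ, hn]
    split_ifs <;> first | omega | simp_all
  · have : min n l.length ≤ S := (min_le_right _ _).trans hlS
    rw [store_ne (by omega), update_self]
    simp
    omega

/-- `tableCmd` performs one round of the iteration. -/
theorem execLE_tableCmd {l st : Expr} {p q w : Polynomial ℕ} (hl : CompileSpec l p)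
    (hst : CompileSpec st q)
    (hw : ∀ (ρ : Env) (S : ℕ), (∀ i, (ρ i).length ≤ S) → st.eval ρ ≤ w.eval S)
    {r : ℕ → ℕ} {b : ℕ} {s : Store} {ρ : Env} {S : ℕ} {T : List Symbol} (hr : ∀ i, r i < b)
    (hb : ∀ k, b + 2 ≤ k → s k = []) (hs : ∀ i, s (r i) = ρ i) (hS : ∀ i, (ρ i).length ≤ S)
    (hT : s (b + 1) = T) (hTS : T.length ≤ S) (hn : l.eval ρ ≤ S) :
    ExecLE (tableCmd (compile l r (b + 4) (b + 3))
        (compile st (consEnv (b + 4) (consEnv (b + 1) r)) (b + 6) (b + 5)) b) s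
      (update s (b + 1) (tableStep (l.eval ρ) (fun T i =>
        decide (st.eval (consEnv (List.replicate i tt) (consEnv T ρ)) ≠ 0)) T))
      (p.eval S + S * (q.eval S + 2 * w.eval S + 12) + 4) := by
  have h1 := hl.run (r := r) (b := b + 3) (fun i => (hr i).trans (by omega))
    (fun k hk => hb k (by omega)) hs hS
  obtain ⟨n, hn'⟩ : ∃ n, l.eval ρ = n := ⟨_, rfl⟩
  rw [hn'] at h1 hn ⊢
  set g : ℕ → ℕ := fun i => st.eval (consEnv (List.replicate i tt) (consEnv T ρ)) with hg
  have hb2 := hb (b + 2) (by omega)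
  have hb3 := hb (b + 3) (by omega)
  have hb4 := hb (b + 4) (by omega)
  have hb5 := hb (b + 5) (by omega)
  have h2 : ExecLE (whl (b + 3) <| seq (pop (b + 3)) <|
      seq (compile st (consEnv (b + 4) (consEnv (b + 1) r)) (b + 6) (b + 5)) <|
      seq (ite (b + 5) Option.isSome (push (b + 2) tt) (push (b + 2) (.bit false))) <|
      seq (clear (b + 5)) (push (b + 4) tt)) (update s (b + 3) (List.replicate n tt))
      (update (update s (b + 4) (List.replicate n tt)) (b + 2)
        ((List.range n).map fun i => Symbol.bit (decide (g i ≠ 0))).reverse)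
      (n * ((1 + (q.eval S + (2 + ((w.eval S * 2 + 1) + 1)))) + 1) + 1) :=
    execLE_whl n (fun i => update (update (update s (b + 3) (List.replicate (n - i) tt))
        (b + 4) (List.replicate i tt)) (b + 2)
        ((List.range i).map fun i => Symbol.bit (decide (g i ≠ 0))).reverse)
      (by
        funext j
        simp only [update_apply]
        split_ifs <;> first | omega | simp_all)
      (by
        funext j
        simp only [update_apply]
        split_ifs <;> first | omega | simp_all)
      (fun i hi => by
        rw [store_ne (by omega), store_ne (by omega), update_self]
        simp
        omega)
      (by rw [store_ne (by omega), store_ne (by omega), update_self]; simp)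
      (fun i hi => by
        have hρ' : ∀ k, ((consEnv (List.replicate i tt) (consEnv T ρ)) k).length ≤ S :=
          forall_consEnv (p := fun _ (l : List Symbol) => l.length ≤ _) (by simp; omega)
            (forall_consEnv (p := fun _ (l : List Symbol) => l.length ≤ _) hTS hS)
        have hgi : g i ≤ w.eval S := hw _ S hρ'
        refine ((execLE_pop _ _).seq ((hst.run (ρ := consEnv (List.replicate i tt) (consEnv T ρ))
          ?_ ?_ ?_ hρ').seq ((execLE_ite (t := 1)
            (s' := update (update (update (update s (b + 3) (List.replicate (n - (i + 1)) tt))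
              (b + 4) (List.replicate i tt)) (b + 2)
              ((List.range (i + 1)).map fun i => Symbol.bit (decide (g i ≠ 0))).reverse)
              (b + 5) (List.replicate (g i) tt)) (fun h => ?_) (fun h => ?_)).seq
          (((execLE_clear _ _).mono ?_).seq (execLE_push _ _ _))))).congr ?_
        · exact forall_consEnv (p := fun _ (k : ℕ) => k < b + 5) (by omega)
            (forall_consEnv (p := fun _ (k : ℕ) => k < b + 5) (by omega)
              fun k => (hr k).trans (by omega))
        · intro k hk
          simp only [update_apply]
          split_ifs <;> first | omega | exact hb k (by omega)
        · rintro (_ | _ | k)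
          · simp only [consEnv_zero, update_apply]
            split_ifs <;> first | omega | rfl
          · simp only [consEnv_zero, consEnv_succ, update_apply]
            split_ifs <;> omega
          · have h3 := hr k
            simp only [consEnv_succ, update_apply]
            split_ifs <;> first | omega | exact hs k
        · have hgi : g i ≠ 0 := by
            intro h0
            rw [update_self] at h
            change (List.replicate (g i) tt).head?.isSome = true at h
            simp [h0] at h
          refine (execLE_push _ _ _).congr ?_
          funext j
          simp only [update_apply, List.range_succ]
          split_ifs <;> first | omega | rfl | simp [hgi, Nat.sub_sub]
        · have hgi : g i = 0 := by
            by_contra h0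
            rw [update_self] at h
            change (List.replicate (g i) tt).head?.isSome = false at h
            simp [h0, List.head?_replicate] at h
          refine (execLE_push _ _ _).congr ?_
          funext j
          simp only [update_apply, List.range_succ]
          split_ifs <;> first | omega | rfl | simp [hgi, Nat.sub_sub]
        · rw [update_self]
          simp
          omega
        · funext j
          simp only [update_apply]
          split_ifs <;> first | omega | simp_all [List.replicate_succ])
  refine ((h1.seq (h2.seq ((execLE_clear (b + 4) _).seq ((execLE_clear (b + 1) _).seq
    (execLE_moveAll (k := b + 2) (l := b + 1) (by omega) _))))).congr ?_).mono ?_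
  · funext j
    simp only [update_apply, tableStep]
    split_ifs <;> first | omega | simp_all
  · have h3 : n * (q.eval S + 2 * w.eval S + 6) ≤ S * (q.eval S + 2 * w.eval S + 6) :=
      Nat.mul_le_mul_right _ hn
    simp [hT]
    nlinarith

theorem compileSpec_iter {c l st f : Expr} {pc p q pf uc u w : Polynomial ℕ}
    (hc : CompileSpec c pc) (hl : CompileSpec l p) (hst : CompileSpec st q)
    (hf : CompileSpec f pf)
    (huc : ∀ (ρ : Env) (S : ℕ), (∀ i, (ρ i).length ≤ S) → c.eval ρ ≤ uc.eval S)
    (hu : ∀ (ρ : Env) (S : ℕ), (∀ i, (ρ i).length ≤ S) → l.eval ρ ≤ u.eval S)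
    (hw : ∀ (ρ : Env) (S : ℕ), (∀ i, (ρ i).length ≤ S) → st.eval ρ ≤ w.eval S) :
    CompileSpec (iter c l st f) (pc + uc * ((p + Polynomial.X * (q + 2 * w + 12) + 6).comp
      (Polynomial.X + u)) + pf.comp (Polynomial.X + u) + 2 * u + 2) := by
  intro r b out s ρ S hout hr hro hb hs hS
  have h1 := hc.run hr hb hs hS
  have hu := hu ρ S hS
  have huc := huc ρ S hS
  obtain ⟨n, hn⟩ : ∃ n, c.eval ρ = n := ⟨_, rfl⟩
  obtain ⟨m, hm⟩ : ∃ m, u.eval S = m := ⟨_, rfl⟩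
  rw [hn] at h1 huc
  rw [hm] at hu
  set F := tableStep (l.eval ρ) fun T i =>
    decide (st.eval (consEnv (List.replicate i tt) (consEnv T ρ)) ≠ 0) with hF
  have hlen : ∀ i, (F^[i] []).length ≤ m := fun i =>
    (length_iterate_tableStep_le _ _ _).trans hu
  have hb0 := hb b le_rfl
  have hb1 := hb (b + 1) (by omega)
  have h2 : ExecLE (whl b <| seq (pop b) <| tableCmd (compile l r (b + 4) (b + 3))
      (compile st (consEnv (b + 4) (consEnv (b + 1) r)) (b + 6) (b + 5)) b)
      (update s b (List.replicate n tt)) (update s (b + 1) (F^[n] []))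
      (n * ((1 + (p.eval (S + m) + (S + m) * (q.eval (S + m) + 2 * w.eval (S + m) + 12) + 4))
        + 1) + 1) :=
    execLE_whl n (fun i => update (update s b (List.replicate (n - i) tt)) (b + 1) (F^[i] []))
      (by
        funext j
        simp only [update_apply]
        split_ifs <;> first | omega | simp_all)
      (by
        funext j
        simp only [update_apply]
        split_ifs <;> first | omega | simp_all)
      (fun i hi => by
        rw [store_ne (by omega), update_self]
        simp
        omega)
      (by rw [store_ne (by omega), update_self]; simp)
      (fun i hi => by
        refine ((execLE_pop _ _).seq (execLE_tableCmd (T := F^[i] []) (ρ := ρ) hl hst hw hr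
          ?_ ?_ (fun k => (hS k).trans (by omega)) ?_ ((hlen i).trans (by omega))
          (hu.trans (by omega)))).congr ?_
        · intro k hk
          simp only [update_apply]
          split_ifs <;> first | omega | exact hb k (by omega)
        · intro k
          have h3 := hr k
          simp only [update_apply]
          split_ifs <;> first | omega | exact hs k
        · rw [store_ne (by omega), update_self]
        · rw [iterate_succ_apply', ← hF]
          funext j
          simp only [update_apply]
          split_ifs <;> first | omega | simp [Nat.sub_sub])
  have h3 := hf (consEnv (b + 1) r) (b + 2) out (update s (b + 1) (F^[n] []))
    (consEnv (F^[n] []) ρ) (S + m) (by omega)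
    (forall_consEnv (p := fun _ (k : ℕ) => k < b + 2) (by omega)
      fun k => (hr k).trans (by omega))
    (forall_consEnv (p := fun _ (k : ℕ) => k ≠ out) (by omega) hro)
    (fun k hk => by rw [store_ne (by omega), hb k (by omega)])
    (by
      rintro (_ | k)
      · simp
      · have h3 := hr k
        rw [consEnv_succ, consEnv_succ, store_ne (by omega), hs])
    (forall_consEnv (p := fun _ (l : List Symbol) => l.length ≤ _) ((hlen n).trans (by omega))
      fun k => (hS k).trans (by omega))
  refine ((h1.seq (h2.seq (h3.seq (execLE_clear _ _)))).congr ?_).mono ?_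
  · have : (iter c l st f).eval ρ = f.eval (consEnv (F^[n] []) ρ) := by
      simp only [Expr.eval, hn, hF]
    rw [this]
    funext j
    simp only [update_apply]
    split_ifs <;> first | omega | simp_all
  · rw [store_ne (by omega), update_self]
    have h5 := hlen n
    have h4 := Nat.mul_le_mul_right (p.eval (S + m) + (S + m) * (q.eval (S + m) +
      2 * w.eval (S + m) + 12) + 6) huc
    simp [hm]
    nlinarith

/-- Every expression is evaluated by its program in polynomial time. -/
theorem exists_compileSpec : ∀ e : Expr, ∃ p, CompileSpec e p
  | len x => ⟨_, compileSpec_len x⟩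
  | get x e => by
    obtain ⟨p, hp⟩ := exists_compileSpec e
    obtain ⟨u, hu⟩ := exists_eval_le e
    exact ⟨_, compileSpec_get x hp hu⟩
  | one => ⟨_, compileSpec_one⟩
  | add e f => by
    obtain ⟨p, hp⟩ := exists_compileSpec e
    obtain ⟨q, hq⟩ := exists_compileSpec f
    exact ⟨_, compileSpec_add hp hq⟩
  | sub e f => by
    obtain ⟨p, hp⟩ := exists_compileSpec e
    obtain ⟨q, hq⟩ := exists_compileSpec f
    obtain ⟨u, hu⟩ := exists_eval_le e
    obtain ⟨v, hv⟩ := exists_eval_le f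
    exact ⟨_, compileSpec_sub hp hq hu hv⟩
  | sum e f => by
    obtain ⟨p, hp⟩ := exists_compileSpec e
    obtain ⟨q, hq⟩ := exists_compileSpec f
    obtain ⟨u, hu⟩ := exists_eval_le e
    exact ⟨_, compileSpec_sum hp hq hu⟩
  | iter c l st f => by
    obtain ⟨pc, hc⟩ := exists_compileSpec c
    obtain ⟨p, hl⟩ := exists_compileSpec l
    obtain ⟨q, hst⟩ := exists_compileSpec st
    obtain ⟨pf, hf⟩ := exists_compileSpec f
    obtain ⟨uc, huc⟩ := exists_eval_le c
    obtain ⟨u, hu⟩ := exists_eval_le l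
    obtain ⟨w, hw⟩ := exists_eval_le st
    exact ⟨_, compileSpec_iter hc hl hst hf huc hu hw⟩

end Expr

/-- The environment of an input word: it is variable `0`. -/
def wordEnv (w : List Symbol) : Env := consEnv w fun _ => []

open Cmd in
/-- A problem is decidable in polynomial time if some expression in the input word is nonzero
exactly on the positive instances. -/
theorem polyTimeDecidable_of_expr {α : Type} {enc : α → List Symbol} {Q : α → Prop} (e : Expr)
    (he : ∀ a, e.eval (wordEnv (enc a)) ≠ 0 ↔ Q a) : PolyTimeDecidable enc Q := by
  obtain ⟨p, hp⟩ := e.exists_compileSpec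
  obtain ⟨u, hu⟩ := e.exists_eval_le
  -- register `1` stays empty during the evaluation, and stands for all the unused variables
  refine polyTimeDecidable_of_exec (seq (e.compile (consEnv 0 fun _ => 1) 3 2) <|
    seq (ite 2 Option.isSome (push 1 tt) (pop 1)) <| seq (clear 2) (clear 0))
    (p + 2 * u + 2 * Polynomial.X + 4) fun a => ?_
  set w := enc a
  have hlen : ∀ i, (wordEnv w i).length ≤ w.length :=
    forall_consEnv (p := fun _ (l : List Symbol) => l.length ≤ _) le_rfl (by simp)
  have h1 := hp.run (b := 2) (r := consEnv 0 fun _ => 1) (s := update (fun _ => []) 0 w)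
    (ρ := wordEnv w) (forall_consEnv (p := fun _ (k : ℕ) => k < 2) (by omega) (by simp))
    (fun k hk => Expr.store_ne (s := fun _ => []) (by omega))
    (by rintro (_ | k) <;> simp [wordEnv]) hlen
  have hu := hu _ _ hlen
  have h2 : ExecLE (seq (e.compile (consEnv 0 fun _ => 1) 3 2) <|
      seq (ite 2 Option.isSome (push 1 tt) (pop 1)) <| seq (clear 2) (clear 0))
      (update (fun _ => []) 0 w) (update (fun _ => []) 1 (if e.eval (wordEnv w) ≠ 0 then [tt]
        else [])) ((p + 2 * u + 2 * Polynomial.X + 4).eval w.length) := by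
    refine ((h1.seq ((execLE_ite (t := 1)
      (s' := update (update (update (fun _ => []) 0 w) 2 (List.replicate (e.eval (wordEnv w)) tt))
        1 (if e.eval (wordEnv w) ≠ 0 then [tt] else [])) (fun h => ?_) fun h => ?_).seq
      ((execLE_clear _ _).seq (execLE_clear _ _)))).congr ?_).mono ?_
    · have h0 : e.eval (wordEnv w) ≠ 0 := by
        intro h0
        simp [h0] at h
      exact (execLE_push _ _ _).congr (by simp [h0])
    · have h0 : e.eval (wordEnv w) = 0 := by
        by_contra h0
        simp [h0, List.head?_replicate] at h
      exact (execLE_pop _ _).congr (by simp [h0])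
    · funext j
      simp only [update_apply]
      split_ifs <;> first | omega | simp_all
    · simp
      omega
  obtain ⟨t, ht, h⟩ := h2
  refine ⟨t, ht, ?_⟩
  convert h
  exact (he a).symm

/-! ### Feasible functions and predicates -/

namespace Expr

/-- Renaming of the variables under a binder. -/
def liftRen (ξ : ℕ → ℕ) : ℕ → ℕ
  | 0 => 0
  | n + 1 => ξ n + 1

/-- Renaming of the variables of an expression. -/
def rename : Expr → (ℕ → ℕ) → Expr
  | len x, ξ => len (ξ x)
  | get x e, ξ => get (ξ x) (e.rename ξ)
  | one, _ => one
  | add e f, ξ => add (e.rename ξ) (f.rename ξ)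
  | sub e f, ξ => sub (e.rename ξ) (f.rename ξ)
  | sum e f, ξ => sum (e.rename ξ) (f.rename (liftRen ξ))
  | iter c l st f, ξ => iter (c.rename ξ) (l.rename ξ) (st.rename (liftRen (liftRen ξ)))
      (f.rename (liftRen ξ))

theorem consEnv_comp_liftRen (l : List Symbol) (ρ : Env) (ξ : ℕ → ℕ) :
    consEnv l ρ ∘ liftRen ξ = consEnv l (ρ ∘ ξ) := by
  funext n
  cases n <;> rfl

theorem eval_rename (e : Expr) : ∀ (ξ : ℕ → ℕ) (ρ : Env),
    (e.rename ξ).eval ρ = e.eval (ρ ∘ ξ) := by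
  induction e with
  | len x => intros; rfl
  | get x e ih => intros; simp [rename, eval, ih]
  | one => intros; rfl
  | add e f ihe ihf => intros; simp [rename, eval, ihe, ihf]
  | sub e f ihe ihf => intros; simp [rename, eval, ihe, ihf]
  | sum e f ihe ihf => intros; simp [rename, eval, ihe, ihf, consEnv_comp_liftRen]
  | iter c l st f ihc ihl ihst ihf =>
    intros
    simp only [rename, eval, ihc, ihl, ihst, ihf, consEnv_comp_liftRen]

end Expr

/-- Data that can be the value of a variable. -/
class Datum (τ : Type) where
  /-- The value of the variable; a natural number is written in unary. -/
  toStack : τ → List Symbol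

instance : Datum ℕ := ⟨fun n => List.replicate n tt⟩

instance : Datum (List Symbol) := ⟨id⟩

/-- Types of data whose parts are accessible as the values of variables. -/
class Context (α : Type) where
  /-- The values of the variables. -/
  env : α → Env

/-- The last component of a pair is variable `0`. Bound variables are represented in this way, as
`α × ℕ`. -/
instance {α τ : Type} [Context α] [Datum τ] : Context (α × τ) :=
  ⟨fun a => consEnv (Datum.toStack a.2) (Context.env a.1)⟩

section Feasible

variable {α β γ τ : Type} [Context α] [Context β] [Context γ] [Datum τ]

/-- Number-valued functions given by an expression, hence computable in polynomial time. -/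
def Feasible (f : α → ℕ) : Prop := ∃ e : Expr, ∀ a, e.eval (Context.env a) = f a

/-- Predicates given by an expression, hence decidable in polynomial time. -/
def FeasiblePred (p : α → Prop) : Prop := ∃ e : Expr, ∀ a, e.eval (Context.env a) ≠ 0 ↔ p a

/-- `T` is the value of a variable. -/
def IsVar (T : α → List Symbol) : Prop := ∃ n, ∀ a, Context.env a n = T a

/-- Maps of contexts that forget some variables. -/
def IsProj (π : β → α) : Prop := ∃ ξ : ℕ → ℕ, ∀ b, Context.env (π b) = Context.env b ∘ ξ

theorem IsProj.id : IsProj fun a : α => a := ⟨fun n => n, fun _ => rfl⟩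

theorem IsProj.fst : IsProj fun a : α × τ => a.1 := ⟨Nat.succ, fun _ => rfl⟩

theorem IsProj.comp {π : β → α} {π' : γ → β} (h : IsProj π) (h' : IsProj π') :
    IsProj fun c => π (π' c) := by
  obtain ⟨ξ, h⟩ := h
  obtain ⟨ξ', h'⟩ := h'
  exact ⟨ξ' ∘ ξ, fun c => by rw [h, h']; rfl⟩

theorem IsProj.wk {π : β → α} (h : IsProj π) : IsProj fun x : β × τ => π x.1 := h.comp .fst

theorem IsProj.lift {π : β → α} (h : IsProj π) : IsProj fun x : β × τ => (π x.1, x.2) := by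
  obtain ⟨ξ, h⟩ := h
  refine ⟨Expr.liftRen ξ, fun x => ?_⟩
  change consEnv _ (Context.env (π x.1)) = consEnv _ (Context.env x.1) ∘ _
  rw [Expr.consEnv_comp_liftRen, h]

theorem isVar_snd : IsVar fun x : α × τ => Datum.toStack x.2 := ⟨0, fun _ => rfl⟩

theorem IsVar.proj {T : α → List Symbol} (h : IsVar T) {π : β → α} (hπ : IsProj π) :
    IsVar fun b => T (π b) := by
  obtain ⟨n, h⟩ := h
  obtain ⟨ξ, hπ⟩ := hπ
  exact ⟨ξ n, fun b => (congrFun (hπ b) n).symm.trans (h (π b))⟩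

theorem Feasible.proj {f : α → ℕ} (hf : Feasible f) {π : β → α} (hπ : IsProj π) :
    Feasible fun b => f (π b) := by
  obtain ⟨e, hf⟩ := hf
  obtain ⟨ξ, hπ⟩ := hπ
  exact ⟨e.rename ξ, fun b => by rw [Expr.eval_rename, ← hπ, hf]⟩

theorem FeasiblePred.proj {p : α → Prop} (hp : FeasiblePred p) {π : β → α} (hπ : IsProj π) :
    FeasiblePred fun b => p (π b) := by
  obtain ⟨e, hp⟩ := hp
  obtain ⟨ξ, hπ⟩ := hπ
  exact ⟨e.rename ξ, fun b => by rw [Expr.eval_rename, ← hπ, hp]⟩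

theorem IsVar.length {T : α → List Symbol} (h : IsVar T) : Feasible fun a => (T a).length := by
  obtain ⟨n, h⟩ := h
  exact ⟨.len n, fun a => by rw [Expr.eval, h]⟩

theorem Feasible.var0 : Feasible fun x : α × ℕ => x.2 := by
  simpa [Datum.toStack] using (isVar_snd (α := α) (τ := ℕ)).length

theorem Feasible.wk {f : α → ℕ} (hf : Feasible f) : Feasible fun x : α × τ => f x.1 :=
  hf.proj .fst

theorem Feasible.var1 : Feasible fun x : (α × ℕ) × ℕ => x.1.2 := Feasible.var0.wk

theorem Feasible.var2 : Feasible fun x : ((α × ℕ) × ℕ) × ℕ => x.1.1.2 := Feasible.var1.wk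

theorem Feasible.var3 : Feasible fun x : (((α × ℕ) × ℕ) × ℕ) × ℕ => x.1.1.1.2 := Feasible.var2.wk

theorem Feasible.add {f g : α → ℕ} (hf : Feasible f) (hg : Feasible g) :
    Feasible fun a => f a + g a := by
  obtain ⟨e, he⟩ := hf
  obtain ⟨e', he'⟩ := hg
  exact ⟨.add e e', fun a => by rw [Expr.eval, he, he']⟩

theorem Feasible.sub {f g : α → ℕ} (hf : Feasible f) (hg : Feasible g) :
    Feasible fun a => f a - g a := by
  obtain ⟨e, he⟩ := hf
  obtain ⟨e', he'⟩ := hg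
  exact ⟨.sub e e', fun a => by rw [Expr.eval, he, he']⟩

theorem Feasible.const : ∀ n : ℕ, Feasible fun _ : α => n
  | 0 => ⟨.sub .one .one, fun _ => rfl⟩
  | n + 1 => (Feasible.const n).add ⟨.one, fun _ => rfl⟩

theorem Feasible.sum {f : α → ℕ} {g : α → ℕ → ℕ} (hf : Feasible f)
    (hg : Feasible fun x : α × ℕ => g x.1 x.2) :
    Feasible fun a => ∑ i ∈ Finset.range (f a), g a i := by
  obtain ⟨e, he⟩ := hf
  obtain ⟨e', he'⟩ := hg
  exact ⟨.sum e e', fun a => by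
    rw [Expr.eval, he]
    exact Finset.sum_congr rfl fun i _ => he' (a, i)⟩

theorem Feasible.mul {f g : α → ℕ} (hf : Feasible f) (hg : Feasible g) :
    Feasible fun a => f a * g a := by
  have := hf.sum (g := fun a _ => g a) hg.wk
  simpa using this

theorem Feasible.get {T : α → List Symbol} (h : IsVar T) {g : α → ℕ} (hg : Feasible g) :
    Feasible fun a => ((T a)[g a]?.map Symbol.toNat).getD 0 := by
  obtain ⟨n, h⟩ := h
  obtain ⟨e, he⟩ := hg
  exact ⟨.get n e, fun a => by rw [Expr.eval, h, he]⟩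

theorem FeasiblePred.congr {p q : α → Prop} (hp : FeasiblePred p) (h : ∀ a, p a ↔ q a) :
    FeasiblePred q := by
  obtain ⟨e, he⟩ := hp
  exact ⟨e, fun a => (he a).trans (h a)⟩

theorem Feasible.congr {f g : α → ℕ} (hf : Feasible f) (h : ∀ a, f a = g a) : Feasible g := by
  obtain ⟨e, he⟩ := hf
  exact ⟨e, fun a => (he a).trans (h a)⟩

theorem Feasible.ne_zero {f : α → ℕ} (hf : Feasible f) : FeasiblePred fun a => f a ≠ 0 := by
  obtain ⟨e, he⟩ := hf
  exact ⟨e, fun a => by rw [he]⟩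

theorem FeasiblePred.false : FeasiblePred fun _ : α => False :=
  (Feasible.const 0).ne_zero.congr fun _ => by simp

theorem FeasiblePred.true : FeasiblePred fun _ : α => True :=
  (Feasible.const 1).ne_zero.congr fun _ => by simp

theorem FeasiblePred.not {p : α → Prop} (hp : FeasiblePred p) : FeasiblePred fun a => ¬p a := by
  obtain ⟨e, he⟩ := hp
  refine ⟨.sub .one e, fun a => ?_⟩
  have := he a
  simp only [Expr.eval, ← this]
  omega

theorem FeasiblePred.or {p q : α → Prop} (hp : FeasiblePred p) (hq : FeasiblePred q) :
    FeasiblePred fun a => p a ∨ q a := by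
  obtain ⟨e, he⟩ := hp
  obtain ⟨e', he'⟩ := hq
  refine ⟨.add e e', fun a => ?_⟩
  simp only [Expr.eval, ← he a, ← he' a]
  omega

theorem FeasiblePred.and {p q : α → Prop} (hp : FeasiblePred p) (hq : FeasiblePred q) :
    FeasiblePred fun a => p a ∧ q a :=
  (hp.not.or hq.not).not.congr fun a => by tauto

theorem FeasiblePred.imp {p q : α → Prop} (hp : FeasiblePred p) (hq : FeasiblePred q) :
    FeasiblePred fun a => p a → q a :=
  (hp.not.or hq).congr fun a => by tauto

open Classical in
theorem FeasiblePred.indicator {p : α → Prop} (hp : FeasiblePred p) :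
    Feasible fun a => if p a then 1 else 0 := by
  obtain ⟨e, he⟩ := hp
  refine ⟨.sub .one (.sub .one e), fun a => ?_⟩
  have := he a
  simp only [Expr.eval]
  split_ifs with h
  · rw [← he] at h
    omega
  · rw [← he] at h
    omega

theorem Feasible.lt {f g : α → ℕ} (hf : Feasible f) (hg : Feasible g) :
    FeasiblePred fun a => f a < g a :=
  (hg.sub hf).ne_zero.congr fun a => by omega

theorem Feasible.le {f g : α → ℕ} (hf : Feasible f) (hg : Feasible g) :
    FeasiblePred fun a => f a ≤ g a :=
  (hg.lt hf).not.congr fun a => by omega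

theorem Feasible.eq {f g : α → ℕ} (hf : Feasible f) (hg : Feasible g) :
    FeasiblePred fun a => f a = g a :=
  ((hf.le hg).and (hg.le hf)).congr fun a => by omega

theorem FeasiblePred.exists_lt {f : α → ℕ} {p : α → ℕ → Prop} (hf : Feasible f)
    (hp : FeasiblePred fun x : α × ℕ => p x.1 x.2) : FeasiblePred fun a => ∃ i < f a, p a i := by
  classical
  refine (hf.sum (g := fun a i => if p a i then 1 else 0) hp.indicator).ne_zero.congr fun a => ?_
  rw [← Nat.pos_iff_ne_zero, Finset.sum_pos_iff]
  refine exists_congr fun i => ?_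
  rw [Finset.mem_range]
  split_ifs with h <;> simp [h]

theorem FeasiblePred.forall_lt {f : α → ℕ} {p : α → ℕ → Prop} (hf : Feasible f)
    (hp : FeasiblePred fun x : α × ℕ => p x.1 x.2) : FeasiblePred fun a => ∀ i < f a, p a i :=
  (FeasiblePred.exists_lt (p := fun a i => ¬p a i) hf hp.not).not.congr fun a => by simp

open Classical in
theorem Feasible.card_filter {f : α → ℕ} {p : α → ℕ → Prop} (hf : Feasible f)
    (hp : FeasiblePred fun x : α × ℕ => p x.1 x.2) :
    Feasible fun a => ((Finset.range (f a)).filter fun i => p a i).card :=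
  (hf.sum (g := fun a i => if p a i then 1 else 0) hp.indicator).congr fun a => by
    rw [Finset.card_filter]

/-- Substitution of a feasible function for the last variable. -/
theorem FeasiblePred.subst {p : α → ℕ → Prop} {g : α → ℕ}
    (hp : FeasiblePred fun x : α × ℕ => p x.1 x.2) (hg : Feasible g) :
    FeasiblePred fun a => p a (g a) :=
  (FeasiblePred.exists_lt (p := fun a i => i = g a ∧ p a i) (hg.add (.const 1))
    ((Feasible.var0.eq hg.wk).and hp)).congr fun a => by
    constructor
    · rintro ⟨i, _, rfl, h⟩
      exact h
    · exact fun h => ⟨g a, Nat.lt_succ_self _, rfl, h⟩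

theorem FeasiblePred.comp {p : α → ℕ → Prop} (hp : FeasiblePred fun x : α × ℕ => p x.1 x.2)
    {π : β → α} (hπ : IsProj π) {g : β → ℕ} (hg : Feasible g) :
    FeasiblePred fun b => p (π b) (g b) :=
  FeasiblePred.subst (p := fun b i => p (π b) i) (hp.proj (hπ.lift (τ := ℕ))) hg

theorem FeasiblePred.comp₂ {p : α → ℕ → ℕ → Prop}
    (hp : FeasiblePred fun x : (α × ℕ) × ℕ => p x.1.1 x.1.2 x.2)
    {π : β → α} (hπ : IsProj π) {g h : β → ℕ} (hg : Feasible g) (hh : Feasible h) :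
    FeasiblePred fun b => p (π b) (g b) (h b) := by
  have h1 : FeasiblePred fun x : (β × ℕ) × ℕ => p (π x.1.1) x.1.2 x.2 :=
    hp.proj (hπ.lift (τ := ℕ)).lift
  have h2 : FeasiblePred fun x : β × ℕ => p (π x.1) x.2 (h x.1) :=
    FeasiblePred.subst (p := fun (x : β × ℕ) i => p (π x.1) x.2 i) h1 hh.wk
  exact FeasiblePred.subst (p := fun b i => p (π b) i (h b)) h2 hg

theorem FeasiblePred.comp₃ {p : α → ℕ → ℕ → ℕ → Prop}
    (hp : FeasiblePred fun x : ((α × ℕ) × ℕ) × ℕ => p x.1.1.1 x.1.1.2 x.1.2 x.2)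
    {π : β → α} (hπ : IsProj π) {f g h : β → ℕ} (hf : Feasible f) (hg : Feasible g)
    (hh : Feasible h) : FeasiblePred fun b => p (π b) (f b) (g b) (h b) := by
  have h1 : FeasiblePred fun x : β × ℕ => p (π x.1) x.2 (g x.1) (h x.1) :=
    FeasiblePred.comp₂ (α := α × ℕ) (p := fun y i j => p y.1 y.2 i j) hp
      (hπ.lift (τ := ℕ)) hg.wk hh.wk
  exact FeasiblePred.subst (p := fun b i => p (π b) i (g b) (h b)) h1 hf

theorem Symbol.toNat_eq_one {a : Symbol} : a.toNat = 1 ↔ a = tt := by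
  rcases a with (_ | _) | _ | _ <;> simp [Symbol.toNat]

theorem Symbol.toNat_eq_two {a : Symbol} : a.toNat = 2 ↔ a = .endRow := by
  rcases a with (_ | _) | _ | _ <;> simp [Symbol.toNat]

theorem FeasiblePred.get_eq_tt {T : α → List Symbol} (h : IsVar T) {g : α → ℕ}
    (hg : Feasible g) : FeasiblePred fun a => (T a)[g a]? = some tt :=
  ((Feasible.get h hg).eq (.const 1)).congr fun a => by
    cases (T a)[g a]? <;> simp [Symbol.toNat_eq_one]

theorem FeasiblePred.get_eq_endRow {T : α → List Symbol} (h : IsVar T) {g : α → ℕ}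
    (hg : Feasible g) : FeasiblePred fun a => (T a)[g a]? = some .endRow :=
  ((Feasible.get h hg).eq (.const 2)).congr fun a => by
    cases (T a)[g a]? <;> simp [Symbol.toNat_eq_two]

open Classical in
/-- Feasible predicates are closed under the iteration of a feasible operation on tables. -/
theorem FeasiblePred.iterate {c l : α → ℕ} {st : α → List Symbol → ℕ → Prop}
    {p : α → List Symbol → Prop} (hc : Feasible c) (hl : Feasible l)
    (hst : FeasiblePred fun x : (α × List Symbol) × ℕ => st x.1.1 x.1.2 x.2)
    (hp : FeasiblePred fun x : α × List Symbol => p x.1 x.2) :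
    FeasiblePred fun a => p a ((tableStep (l a) fun T i => decide (st a T i))^[c a] []) := by
  obtain ⟨ec, hc⟩ := hc
  obtain ⟨el, hl⟩ := hl
  obtain ⟨est, hst⟩ := hst
  obtain ⟨ep, hp⟩ := hp
  refine ⟨.iter ec el est ep, fun a => ?_⟩
  rw [Expr.eval, hc, hl]
  have : (fun T i => decide (est.eval (consEnv (List.replicate i tt)
      (consEnv T (Context.env a))) ≠ 0)) = fun T i => decide (st a T i) := by
    funext T i
    exact decide_eq_decide.2 (hst ((a, T), i))
  rw [this]
  exact hp (a, _)

end Feasible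

/-! ### Reading the input word -/

theorem getElem?_flatten_ofFn {α : Type} {ℓ j : ℕ} (hj : j < ℓ) :
    ∀ {n : ℕ} (f : Fin n → List α) (_ : ∀ i, (f i).length = ℓ) (i : Fin n),
      (List.ofFn f).flatten[(i : ℕ) * ℓ + j]? = (f i)[j]? := by
  intro n
  induction n with
  | zero => exact fun _ _ i => i.elim0
  | succ n ih =>
    intro f hf i
    rw [List.ofFn_succ, List.flatten_cons]
    refine Fin.cases ?_ (fun i => ?_) i
    · rw [List.getElem?_append_left (by simp [hf, hj])]
      simp
    · rw [List.getElem?_append_right (by simp [hf, Nat.add_mul]; omega), hf]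
      have : ((i.succ : Fin (n + 1)) : ℕ) * ℓ + j - ℓ = (i : ℕ) * ℓ + j := by
        simp [Nat.add_mul]
        omega
      rw [this]
      exact ih _ (fun i => hf i.succ) i

open Classical in
theorem getElem?_encodeRow {m : ℕ} (s : Fin m → Prop) (a : Fin m) (l : List Symbol) :
    (encodeRow s ++ l)[(a : ℕ)]? = some (.bit (decide (s a))) := by
  rw [encodeRow, List.append_assoc, List.getElem?_append_left (by simp)]
  simp

theorem getElem?_encodeRow_endRow {m : ℕ} (s : Fin m → Prop) (l : List Symbol) :
    (encodeRow s ++ l)[m]? = some .endRow := by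
  rw [encodeRow, List.append_assoc, List.getElem?_append_right (by simp)]
  simp

open Classical in
theorem getElem?_encodeRel {m : ℕ} (R : Fin m → Fin m → Prop) (a b : Fin m) (l : List Symbol) :
    (encodeRel R ++ l)[(a : ℕ) * (m + 1) + b]? = some (.bit (decide (R a b))) := by
  have h1 : (a : ℕ) * (m + 1) + b < m * (m + 1) := by
    have := a.2
    have := b.2
    nlinarith
  have h2 : ((List.ofFn fun a => encodeRow (R a)).flatten).length = m * (m + 1) := by
    have := length_encodeRel R
    simp only [encodeRel, List.length_append, List.length_singleton] at this
    omega
  rw [encodeRel, List.append_assoc, List.getElem?_append_left (by omega),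
    getElem?_flatten_ofFn (ℓ := m + 1) (by have := b.2; omega) _
      (fun _ => length_encodeRow _) a]
  simpa using getElem?_encodeRow (R a) b []

namespace Election

open Classical in
theorem getElem?_encode_candidate (I : Election) (a : Fin I.m) :
    I.encode[(a : ℕ)]? = some (.bit (decide (a = I.candidate))) := by
  rw [encode, List.append_assoc, getElem?_encodeRow]
  simp

theorem getElem?_encode_endRow (I : Election) : I.encode[I.m]? = some .endRow := by
  rw [encode, List.append_assoc, getElem?_encodeRow_endRow]

open Classical in
theorem getElem?_encode_tie (I : Election) (a b : Fin I.m) :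
    I.encode[I.m + 1 + (a * (I.m + 1) + b)]? = some (.bit (decide (I.tie a b))) := by
  rw [encode, List.append_assoc, List.getElem?_append_right (by simp [length_encodeRow]),
    length_encodeRow, Nat.add_sub_cancel_left, getElem?_encodeRel]

open Classical in
theorem getElem?_encode_pref (I : Election) (i : Fin I.n) (a b : Fin I.m) :
    I.encode[I.m + 1 + ((I.m * (I.m + 1) + 1) + (i * (I.m * (I.m + 1) + 1) +
      (a * (I.m + 1) + b)))]? = some (.bit (decide (I.pref i a b))) := by
  have h1 : (a : ℕ) * (I.m + 1) + b < I.m * (I.m + 1) + 1 := by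
    have := a.2
    have := b.2
    nlinarith
  rw [encode, List.append_assoc, List.getElem?_append_right (by simp [length_encodeRow]),
    length_encodeRow, Nat.add_sub_cancel_left,
    List.getElem?_append_right (by simp [length_encodeRel]),
    length_encodeRel, Nat.add_sub_cancel_left,
    getElem?_flatten_ofFn h1 _ (fun _ => length_encodeRel _) i]
  simpa using getElem?_encodeRel (I.pref i) a b []

/-- Voter `i` weakly prefers `a` to `b`, for voters and candidates given as natural numbers. -/
def Pref (I : Election) (i a b : ℕ) : Prop :=
  ∃ (hi : i < I.n) (ha : a < I.m) (hb : b < I.m), I.pref ⟨i, hi⟩ ⟨a, ha⟩ ⟨b, hb⟩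

/-- The tiebreaker puts `a` before `b`, for candidates given as natural numbers. -/
def Tie (I : Election) (a b : ℕ) : Prop :=
  ∃ (ha : a < I.m) (hb : b < I.m), I.tie ⟨a, ha⟩ ⟨b, hb⟩

theorem pref_iff (I : Election) (i : Fin I.n) (a b : Fin I.m) : I.Pref i a b ↔ I.pref i a b :=
  ⟨fun ⟨_, _, _, h⟩ => h, fun h => ⟨i.2, a.2, b.2, h⟩⟩

theorem tie_iff (I : Election) (a b : Fin I.m) : I.Tie a b ↔ I.tie a b :=
  ⟨fun ⟨_, _, h⟩ => h, fun h => ⟨a.2, b.2, h⟩⟩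

/-- The word of an election is its only variable. -/
noncomputable instance : Context Election := ⟨fun I => wordEnv I.encode⟩

theorem isVar_encode : IsVar Election.encode := ⟨0, fun _ => rfl⟩

theorem m_lt_length_encode (I : Election) : I.m < I.encode.length := by
  rw [length_encode]
  omega

/-- The number of candidates is the position of the first end marker. -/
theorem feasible_m : Feasible Election.m := by
  classical
  refine (Feasible.card_filter (p := fun I x => ∀ y < x + 1, ¬I.encode[y]? = some .endRow)
    isVar_encode.length (FeasiblePred.forall_lt (Feasible.var0.add (.const 1))
      (FeasiblePred.get_eq_endRow (isVar_encode.proj IsProj.fst.wk) .var0).not)).congr fun I => ?_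
  refine (congrArg Finset.card (?_ : _ = Finset.range I.m)).trans (Finset.card_range _)
  · ext x
    simp only [Finset.mem_filter, Finset.mem_range]
    constructor
    · rintro ⟨_, h⟩
      by_contra hx
      exact h I.m (by omega) I.getElem?_encode_endRow
    · refine fun hx => ⟨hx.trans I.m_lt_length_encode, fun y hy => ?_⟩
      have := I.getElem?_encode_candidate ⟨y, by omega⟩
      simp only at this
      rw [this]
      simp

/-- The number of voters can be read off from the length of the word. -/
theorem feasible_n : Feasible Election.n := by
  classical
  have hm := feasible_m.wk (τ := ℕ)
  refine (Feasible.card_filter (p := fun I q =>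
    I.m + 1 + (q + 2) * (I.m * (I.m + 1) + 1) ≤ I.encode.length) isVar_encode.length
    (Feasible.le ((hm.add (.const 1)).add ((Feasible.var0.add (.const 2)).mul
      ((hm.mul (hm.add (.const 1))).add (.const 1))))
      (isVar_encode.length.wk))).congr fun I => ?_
  refine (congrArg Finset.card (?_ : _ = Finset.range I.n)).trans (Finset.card_range _)
  · ext q
    simp only [Finset.mem_filter, Finset.mem_range, I.length_encode]
    rw [Nat.add_le_add_iff_left, Nat.mul_le_mul_right_iff (Nat.succ_pos _)]
    constructor
    · rintro ⟨_, h⟩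
      omega
    · refine fun h => ⟨?_, by omega⟩
      nlinarith [Nat.zero_le (I.m * (I.m + 1)), Nat.zero_le ((I.n + 1) * (I.m * (I.m + 1)))]

theorem feasible_candidate : Feasible fun I : Election => (I.candidate : ℕ) := by
  classical
  refine (Feasible.card_filter (p := fun I x => ∀ y < x + 1, ¬I.encode[y]? = some tt)
    feasible_m (FeasiblePred.forall_lt (Feasible.var0.add (.const 1))
      (FeasiblePred.get_eq_tt (isVar_encode.proj IsProj.fst.wk) .var0).not)).congr fun I => ?_
  refine (congrArg Finset.card (?_ : _ = Finset.range I.candidate)).trans (Finset.card_range _)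
  · ext x
    simp only [Finset.mem_filter, Finset.mem_range]
    constructor
    · rintro ⟨_, h⟩
      by_contra hx
      exact h I.candidate (by omega) (by simp [I.getElem?_encode_candidate])
    · refine fun hx => ⟨hx.trans I.candidate.2, fun y hy => ?_⟩
      have hy' : y < I.candidate := by omega
      have := I.getElem?_encode_candidate ⟨y, hy'.trans I.candidate.2⟩
      simp only at this
      rw [this]
      simp [Fin.ext_iff, hy'.ne]

theorem feasiblePred_tie :
    FeasiblePred fun x : (Election × ℕ) × ℕ => x.1.1.Tie x.1.2 x.2 := by
  have hm := (feasible_m.wk (τ := ℕ)).wk (τ := ℕ)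
  refine (((Feasible.lt .var1 hm).and (Feasible.lt .var0 hm)).and
    (FeasiblePred.get_eq_tt (isVar_encode.proj (IsProj.fst.wk))
      ((hm.add (.const 1)).add ((Feasible.var1.mul (hm.add (.const 1))).add .var0)))).congr
    fun ⟨⟨I, a⟩, b⟩ => ?_
  constructor
  · rintro ⟨⟨ha, hb⟩, h⟩
    have := I.getElem?_encode_tie ⟨a, ha⟩ ⟨b, hb⟩
    simp only at this h
    rw [this] at h
    exact ⟨ha, hb, by simpa using h⟩
  · rintro ⟨ha, hb, h⟩
    have := I.getElem?_encode_tie ⟨a, ha⟩ ⟨b, hb⟩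
    simp only at this ha hb ⊢
    exact ⟨⟨ha, hb⟩, by rw [this]; simpa using h⟩

theorem feasiblePred_pref :
    FeasiblePred fun x : ((Election × ℕ) × ℕ) × ℕ => x.1.1.1.Pref x.1.1.2 x.1.2 x.2 := by
  have hm := ((feasible_m.wk (τ := ℕ)).wk (τ := ℕ)).wk (τ := ℕ)
  have hn := ((feasible_n.wk (τ := ℕ)).wk (τ := ℕ)).wk (τ := ℕ)
  have hl := (hm.mul (hm.add (.const 1))).add (.const 1)
  refine ((((Feasible.lt .var2 hn).and (Feasible.lt .var1 hm)).and (Feasible.lt .var0 hm)).and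
    (FeasiblePred.get_eq_tt (isVar_encode.proj (IsProj.fst.wk.wk))
      ((hm.add (.const 1)).add (hl.add ((Feasible.var2.mul hl).add
        ((Feasible.var1.mul (hm.add (.const 1))).add .var0)))))).congr
    fun ⟨⟨⟨I, i⟩, a⟩, b⟩ => ?_
  constructor
  · rintro ⟨⟨⟨hi, ha⟩, hb⟩, h⟩
    have := I.getElem?_encode_pref ⟨i, hi⟩ ⟨a, ha⟩ ⟨b, hb⟩
    simp only at this h
    rw [this] at h
    exact ⟨hi, ha, hb, by simpa using h⟩
  · rintro ⟨hi, ha, hb, h⟩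
    have := I.getElem?_encode_pref ⟨i, hi⟩ ⟨a, ha⟩ ⟨b, hb⟩
    simp only at this ha hb hi ⊢
    exact ⟨⟨⟨hi, ha⟩, hb⟩, by rw [this]; simpa using h⟩

end Election

/-! ### The auction algorithm for bipartite matching -/

/-- There is an injective assignment of right vertices below `R` to the active left vertices
below `L`, along edges of `adj`. -/
def Matchable (L R : ℕ) (act : ℕ → Prop) (adj : ℕ → ℕ → Prop) : Prop :=
  ∃ f : ℕ → ℕ, (∀ u < L, act u → f u < R ∧ adj u (f u)) ∧
    ∀ u < L, ∀ u' < L, act u → act u' → f u = f u' → u = u'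

/-- A state of the auction: `own r u` says that the right vertex `r` is sold to the left vertex
`u`; every right vertex has a price. -/
structure Auction where
  own : ℕ → ℕ → Prop
  price : ℕ → ℕ

namespace Auction

variable (L R : ℕ) (act : ℕ → Prop) (adj : ℕ → ℕ → Prop)

/-- The active left vertex `u` owns nothing. -/
def Unmatched (st : Auction) (u : ℕ) : Prop := u < L ∧ act u ∧ ∀ r < R, ¬st.own r u

/-- `r` is a cheapest neighbour of `u`. -/
def Cheapest (st : Auction) (u r : ℕ) : Prop :=
  r < R ∧ adj u r ∧ ∀ r' < R, adj u r' → st.price r ≤ st.price r'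

/-- In the next round, `u` bids for `r`: it is the first unmatched left vertex, and `r` is its
first cheapest neighbour. -/
def Bid (st : Auction) (u r : ℕ) : Prop :=
  (st.Unmatched L R act u ∧ ∀ u' < u, ¬st.Unmatched L R act u') ∧
    st.Cheapest R adj u r ∧ ∀ r' < r, ¬st.Cheapest R adj u r'

open Classical in
/-- One round of the auction: the bid is accepted, and the price rises by one. -/
noncomputable def step (st : Auction) : Auction where
  own r u := st.Bid L R act adj u r ∨ (st.own r u ∧ ¬∃ u', st.Bid L R act adj u' r)
  price r := if ∃ u, st.Bid L R act adj u r then st.price r + 1 else st.price r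

/-- The state of the auction after `t` rounds. -/
noncomputable def run (t : ℕ) : Auction := (step L R act adj)^[t] ⟨fun _ _ => False, fun _ => 0⟩

/-- The invariant of the auction. Each sold vertex was a cheapest choice of its owner up to one
unit, and only sold vertices have a positive price. -/
structure Valid (st : Auction) : Prop where
  edge : ∀ r u, st.own r u → u < L ∧ act u ∧ r < R ∧ adj u r
  left_unique : ∀ r u u', st.own r u → st.own r u' → u = u'
  right_unique : ∀ r r' u, st.own r u → st.own r' u → r = r'
  slack : ∀ r u r', st.own r u → r' < R → adj u r' → st.price r ≤ st.price r' + 1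
  sold : ∀ r, 0 < st.price r → ∃ u, st.own r u

variable {L R act adj}

theorem Bid.unique {st : Auction} {u u' r r' : ℕ} (h : st.Bid L R act adj u r)
    (h' : st.Bid L R act adj u' r') : u = u' ∧ r = r' := by
  obtain ⟨⟨h1, h2⟩, h3, h4⟩ := h
  obtain ⟨⟨h1', h2'⟩, h3', h4'⟩ := h'
  obtain rfl : u = u' := by
    rcases lt_trichotomy u u' with h | h | h
    · exact absurd h1 (h2' _ h)
    · exact h
    · exact absurd h1' (h2 _ h)
  refine ⟨rfl, ?_⟩
  rcases lt_trichotomy r r' with h | h | h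
  · exact absurd h3 (h4' _ h)
  · exact h
  · exact absurd h3' (h4 _ h)

theorem price_le_price_step (st : Auction) (r : ℕ) :
    st.price r ≤ (st.step L R act adj).price r := by
  simp only [step]
  split_ifs <;> omega

theorem Valid.step {st : Auction} (h : st.Valid L R act adj) :
    (st.step L R act adj).Valid L R act adj where
  edge r u hr := by
    rcases hr with hr | hr
    · exact ⟨hr.1.1.1, hr.1.1.2.1, hr.2.1.1, hr.2.1.2.1⟩
    · exact h.edge r u hr.1
  left_unique r u u' hu hu' := by
    rcases hu with hu | hu <;> rcases hu' with hu' | hu'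
    · exact (hu.unique hu').1
    · exact absurd ⟨u, hu⟩ hu'.2
    · exact absurd ⟨u', hu'⟩ hu.2
    · exact h.left_unique r u u' hu.1 hu'.1
  right_unique r r' u hr hr' := by
    rcases hr with hr | hr <;> rcases hr' with hr' | hr'
    · exact (hr.unique hr').2
    · exact absurd hr'.1 (hr.1.1.2.2 r' (h.edge _ _ hr'.1).2.2.1)
    · exact absurd hr.1 (hr'.1.1.2.2 r (h.edge _ _ hr.1).2.2.1)
    · exact h.right_unique r r' u hr.1 hr'.1
  slack r u r' hr hr' hadj := by
    have h1 := price_le_price_step (L := L) (R := R) (act := act) (adj := adj) st r'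
    rcases hr with hr | hr
    · have h2 := hr.2.1.2.2 r' hr' hadj
      have h3 : (st.step L R act adj).price r = st.price r + 1 := if_pos ⟨u, hr⟩
      omega
    · have h2 := h.slack r u r' hr.1 hr' hadj
      have h3 : (st.step L R act adj).price r = st.price r := if_neg hr.2
      omega
  sold r hr := by
    by_cases hb : ∃ u, st.Bid L R act adj u r
    · obtain ⟨u, hu⟩ := hb
      exact ⟨u, Or.inl hu⟩
    · have h3 : (st.step L R act adj).price r = st.price r := if_neg hb
      obtain ⟨u, hu⟩ := h.sold r (h3 ▸ hr)
      exact ⟨u, Or.inr ⟨hu, hb⟩⟩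

theorem run_succ (t : ℕ) : run L R act adj (t + 1) = (run L R act adj t).step L R act adj :=
  Function.iterate_succ_apply' _ _ _

theorem valid_run (t : ℕ) : (run L R act adj t).Valid L R act adj := by
  induction t with
  | zero => exact ⟨fun _ _ h => h.elim, fun _ _ _ h => h.elim, fun _ _ _ h => h.elim,
      fun _ _ _ h => h.elim, fun _ h => absurd h (lt_irrefl 0)⟩
  | succ t ih =>
    rw [run_succ]
    exact ih.step

theorem price_run_le (t r : ℕ) : (run L R act adj t).price r ≤ t := by
  induction t with
  | zero => exact le_rfl
  | succ t ih =>
    rw [run_succ]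
    simp only [step]
    split_ifs <;> omega

/-- When nobody is unmatched any more, the owners form a matching. -/
theorem Valid.matchable {st : Auction} (h : st.Valid L R act adj)
    (hm : ∀ u, ¬st.Unmatched L R act u) : Matchable L R act adj := by
  have h1 : ∀ u, ∃ r, u < L → act u → st.own r u := by
    intro u
    by_contra hc
    push Not at hc
    exact hm u ⟨(hc 0).1, (hc 0).2.1, fun r _ => (hc r).2.2⟩
  choose f hf using h1
  refine ⟨f, fun u hu ha => (h.edge _ _ (hf u hu ha)).2.2, fun u hu u' hu' ha ha' he => ?_⟩
  exact h.left_unique _ _ _ (hf u hu ha) (he ▸ hf u' hu' ha')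

open Classical in
/-- If a matching `f` exists, then an unmatched vertex `u₀` has a cheap neighbour, namely `f u₀`:
otherwise the numbers of owners of vertices of price at least `v` would have to grow as `v`
decreases from the price of `f u₀` to `1`, since `f` maps the owners of vertices of price at least
`v + 1`, and `u₀`, to vertices of price at least `v`. -/
theorem Valid.price_lt {st : Auction} (h : st.Valid L R act adj) {f : ℕ → ℕ}
    (hf : ∀ u < L, act u → f u < R ∧ adj u (f u))
    (hinj : ∀ u < L, ∀ u' < L, act u → act u' → f u = f u' → u = u')
    {u₀ : ℕ} (hu₀ : st.Unmatched L R act u₀) : st.price (f u₀) < L := by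
  set p := st.price (f u₀) with hp
  let U : ℕ → Finset ℕ := fun v => (Finset.range L).filter fun u => ∃ r, st.own r u ∧ v ≤ st.price r
  have hnot : ∀ v, u₀ ∉ U v := by
    intro v hv
    obtain ⟨r, hr, _⟩ := (Finset.mem_filter.1 hv).2
    exact hu₀.2.2 r (h.edge _ _ hr).2.2.1 hr
  have hgrow : ∀ v, 1 ≤ v → v ≤ p → (U (v + 1)).card + 1 ≤ (U v).card := by
    intro v hv hvp
    rw [← Finset.card_insert_of_notMem (hnot (v + 1))]
    have key : ∀ u ∈ insert u₀ (U (v + 1)), u < L ∧ act u ∧ v ≤ st.price (f u) := by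
      intro u hu
      rcases Finset.mem_insert.1 hu with rfl | hu
      · exact ⟨hu₀.1, hu₀.2.1, hvp⟩
      · obtain ⟨hu, r, hr, hvr⟩ := Finset.mem_filter.1 hu
        have he := h.edge _ _ hr
        have h1 := h.slack r u (f u) hr (hf u he.1 he.2.1).1 (hf u he.1 he.2.1).2
        exact ⟨he.1, he.2.1, by omega⟩
    have howner : ∀ u, ∃ o, u ∈ insert u₀ (U (v + 1)) → st.own (f u) o := by
      intro u
      by_cases hu : u ∈ insert u₀ (U (v + 1))
      · obtain ⟨o, ho⟩ := h.sold (f u) (hv.trans (key u hu).2.2)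
        exact ⟨o, fun _ => ho⟩
      · exact ⟨0, fun h => absurd h hu⟩
    choose o ho using howner
    refine Finset.card_le_card_of_injOn o (fun u hu => ?_) fun u hu u' hu' he => ?_
    · exact Finset.mem_coe.2 (Finset.mem_filter.2 ⟨Finset.mem_range.2 (h.edge _ _ (ho u hu)).1,
        f u, ho u hu, (key u hu).2.2⟩)
    · have h1 := h.right_unique _ _ _ (ho u hu) (he ▸ ho u' hu')
      exact hinj u (key u hu).1 u' (key u' hu').1 (key u hu).2.1 (key u' hu').2.1 h1
  have hcount : ∀ j ≤ p, j ≤ (U (p + 1 - j)).card := by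
    intro j
    induction j with
    | zero => simp
    | succ j ih =>
      intro hj
      have h1 := hgrow (p + 1 - (j + 1)) (by omega) (by omega)
      have h2 : p + 1 - (j + 1) + 1 = p + 1 - j := by omega
      rw [h2] at h1
      have := ih (by omega)
      omega
  have h1 := hcount p le_rfl
  have h2 : (insert u₀ (U (p + 1 - p))).card ≤ (Finset.range L).card :=
    Finset.card_le_card (Finset.insert_subset (Finset.mem_range.2 hu₀.1) (Finset.filter_subset _ _))
  rw [Finset.card_insert_of_notMem (hnot _), Finset.card_range] at h2
  omega

theorem exists_bid {st : Auction} {f : ℕ → ℕ} (hf : ∀ u < L, act u → f u < R ∧ adj u (f u))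
    (h : ∃ u, st.Unmatched L R act u) : ∃ u r, st.Bid L R act adj u r := by
  classical
  obtain ⟨u, hu, hmin⟩ : ∃ u, st.Unmatched L R act u ∧ ∀ u' < u, ¬st.Unmatched L R act u' :=
    ⟨Nat.find h, Nat.find_spec h, fun _ hu' => Nat.find_min h hu'⟩
  have hfu := hf u hu.1 hu.2.1
  obtain ⟨r, hr, hrmin⟩ := Finset.exists_min_image ((Finset.range R).filter (adj u)) st.price
    ⟨f u, by simpa using hfu⟩
  have hc : ∃ r, st.Cheapest R adj u r := by
    simp only [Finset.mem_filter, Finset.mem_range] at hr hrmin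
    exact ⟨r, hr.1, hr.2, fun r' h1 h2 => hrmin r' ⟨h1, h2⟩⟩
  exact ⟨u, Nat.find hc, ⟨hu, hmin⟩, Nat.find_spec hc, fun _ hr' => Nat.find_min hc hr'⟩

/-- The auction with sufficiently many rounds decides whether there is a matching: while a vertex
is unmatched, the sum of the prices rises in each round, but the prices cannot exceed `L` if there
is a matching. -/
theorem run_matched_iff :
    (∀ u, ¬(run L R act adj (R * L + 1)).Unmatched L R act u) ↔ Matchable L R act adj := by
  refine ⟨(valid_run _).matchable, ?_⟩
  rintro ⟨f, hf, hinj⟩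
  have hle : ∀ t r, (run L R act adj t).price r ≤ L := by
    intro t r
    induction t with
    | zero => exact Nat.zero_le _
    | succ t ih =>
      rw [run_succ]
      by_cases hb : ∃ u, (run L R act adj t).Bid L R act adj u r
      · refine (if_pos hb).le.trans ?_
        obtain ⟨u, hu⟩ := hb
        have h1 := (valid_run t).price_lt hf hinj hu.1.1
        have h2 := hf u hu.1.1.1 hu.1.1.2.1
        have h3 := hu.2.1.2.2 (f u) h2.1 h2.2
        omega
      · exact (if_neg hb).le.trans ih
  have hsum : ∀ t, (∀ u, ¬(run L R act adj t).Unmatched L R act u) ∨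
      ∑ r ∈ Finset.range R, (run L R act adj t).price r = t := by
    intro t
    induction t with
    | zero => exact Or.inr (Finset.sum_eq_zero fun _ _ => rfl)
    | succ t ih =>
      rw [run_succ]
      by_cases hm : ∃ u, (run L R act adj t).Unmatched L R act u
      · right
        obtain ⟨u, r, hb⟩ := exists_bid hf hm
        have ih := ih.resolve_left (fun h => hm.elim h)
        have h1 : ∀ r', ((run L R act adj t).step L R act adj).price r' =
            (run L R act adj t).price r' + if r' = r then 1 else 0 := by
          intro r'
          by_cases hr : r' = r
          · subst hr
            exact (if_pos ⟨u, hb⟩).trans (by simp)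
          · exact (if_neg fun ⟨u', hb'⟩ => hr (hb'.unique hb).2).trans (by simp [hr])
        have h2 : r ∈ Finset.range R := Finset.mem_range.2 hb.2.1.1
        simp only [h1]
        rw [Finset.sum_add_distrib, ih, Finset.sum_ite_eq' (Finset.range R) r, if_pos h2]
      · left
        push Not at hm
        have hno : ∀ u r, ¬(run L R act adj t).Bid L R act adj u r := fun u r hb => hm u hb.1.1
        intro u hu
        refine hm u ⟨hu.1, hu.2.1, fun r hr ho => hu.2.2 r hr (Or.inr ⟨ho, ?_⟩)⟩
        rintro ⟨u', hu'⟩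
        exact hno _ _ hu'
  refine (hsum _).resolve_right fun h => ?_
  have := Finset.sum_le_card_nsmul (Finset.range R) (run L R act adj (R * L + 1)).price L
    fun r _ => hle _ r
  rw [h, Finset.card_range, smul_eq_mul] at this
  omega

end Auction

/-! ### The auction on tables of bits -/

namespace Auction

/-- The number of rounds of the auction. -/
def rounds (L R : ℕ) : ℕ := R * L + 1

/-- The number of bits that describe the owner and the price of one right vertex: `L` bits for
the owner, and the price in unary. -/
def width (L R : ℕ) : ℕ := L + rounds L R

section Table

variable (L R : ℕ) (act : ℕ → Prop) (adj : ℕ → ℕ → Prop) (T : List Symbol)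

/-- The table says that `u` owns `r`. -/
def TOwn (r u : ℕ) : Prop := T[r * width L R + u]? = some tt

/-- The table says that the price of `r` exceeds `p`. -/
def TPrice (r p : ℕ) : Prop := T[r * width L R + (L + p)]? = some tt

/-- `Unmatched` read from the table, for `u < L`. -/
def TUnmatched (u : ℕ) : Prop := act u ∧ ∀ r < R, ¬TOwn L R T r u

/-- `Cheapest` read from the table, for `r < R`. -/
def TCheapest (u r : ℕ) : Prop :=
  adj u r ∧ ∀ r' < R, adj u r' → ∀ p < rounds L R, TPrice L R T r p → TPrice L R T r' p

/-- `Bid` read from the table, for `u < L` and `r < R`. -/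
def TBid (u r : ℕ) : Prop :=
  (TUnmatched L R act T u ∧ ∀ u' < u, ¬TUnmatched L R act T u') ∧
    TCheapest L R adj T u r ∧ ∀ r' < r, ¬TCheapest L R adj T u r'

/-- The entries of the table after the next round. -/
def TStep (x : ℕ) : Prop :=
  ∃ r < R,
    (∃ u < L, x = r * width L R + u ∧
      (TBid L R act adj T u r ∨ (TOwn L R T r u ∧ ¬∃ u' < L, TBid L R act adj T u' r))) ∨
    (∃ p < rounds L R, x = r * width L R + (L + p) ∧
      (TPrice L R T r p ∨
        ((∃ u' < L, TBid L R act adj T u' r) ∧ (p = 0 ∨ TPrice L R T r (p - 1)))))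

/-- The table describes the state `st`. -/
def Describes (st : Auction) : Prop :=
  ∀ r < R, (∀ u < L, TOwn L R T r u ↔ st.own r u) ∧
    ∀ p < rounds L R, TPrice L R T r p ↔ p < st.price r

variable {L R act adj T}

theorem Describes.unmatched_iff {st : Auction} (h : Describes L R T st) {u : ℕ} (hu : u < L) :
    TUnmatched L R act T u ↔ st.Unmatched L R act u := by
  refine ⟨fun ⟨h1, h2⟩ => ⟨hu, h1, fun r hr ho => h2 r hr (((h r hr).1 u hu).2 ho)⟩,
    fun ⟨_, h1, h2⟩ => ⟨h1, fun r hr ho => h2 r hr (((h r hr).1 u hu).1 ho)⟩⟩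

theorem Describes.cheapest_iff {st : Auction} (h : Describes L R T st)
    (hp : ∀ r, st.price r ≤ rounds L R) {u r : ℕ} (hr : r < R) :
    TCheapest L R adj T u r ↔ st.Cheapest R adj u r := by
  constructor
  · rintro ⟨h1, h2⟩
    refine ⟨hr, h1, fun r' hr' ha => ?_⟩
    by_contra hlt
    have h3 : st.price r' < rounds L R := by
      have := hp r
      omega
    have h4 := h2 r' hr' ha (st.price r') h3 (((h r hr).2 _ h3).2 (by omega))
    have h5 := ((h r' hr').2 _ h3).1 h4
    omega
  · rintro ⟨_, h1, h2⟩
    refine ⟨h1, fun r' hr' ha p hpt h3 => ((h r' hr').2 p hpt).2 ?_⟩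
    have h4 := ((h r hr).2 p hpt).1 h3
    exact h4.trans_le (h2 r' hr' ha)

theorem Describes.bid_iff {st : Auction} (h : Describes L R T st)
    (hp : ∀ r, st.price r ≤ rounds L R) {u r : ℕ} (hu : u < L) (hr : r < R) :
    TBid L R act adj T u r ↔ st.Bid L R act adj u r := by
  unfold TBid Bid
  rw [h.unmatched_iff hu, h.cheapest_iff hp hr]
  refine and_congr (and_congr_right fun _ => ?_) (and_congr_right fun _ => ?_)
  · exact forall₂_congr fun u' hu' => not_congr (h.unmatched_iff (hu'.trans hu))
  · exact forall₂_congr fun r' hr' => not_congr (h.cheapest_iff hp (hr'.trans hr))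

theorem Describes.exists_bid_iff {st : Auction} (h : Describes L R T st)
    (hp : ∀ r, st.price r ≤ rounds L R) {r : ℕ} (hr : r < R) :
    (∃ u < L, TBid L R act adj T u r) ↔ ∃ u, st.Bid L R act adj u r :=
  ⟨fun ⟨u, hu, hb⟩ => ⟨u, (h.bid_iff hp hu hr).1 hb⟩,
    fun ⟨u, hb⟩ => ⟨u, hb.1.1.1, (h.bid_iff hp hb.1.1.1 hr).2 hb⟩⟩

theorem eq_and_eq_of_mul_add_eq {w r r' y y' : ℕ} (hy : y < w) (hy' : y' < w)
    (h : r * w + y = r' * w + y') : r = r' ∧ y = y' := by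
  have hw : 0 < w := by omega
  have h1 := congrArg (· / w) h
  have h2 := congrArg (· % w) h
  simp only [Nat.mul_comm _ w, Nat.mul_add_div hw, Nat.mul_add_mod, Nat.div_eq_of_lt hy,
    Nat.div_eq_of_lt hy', Nat.mod_eq_of_lt hy, Nat.mod_eq_of_lt hy', Nat.add_zero] at h1 h2
  exact ⟨h1, h2⟩

open Classical in
theorem getElem?_tableStep {n : ℕ} {f : List Symbol → ℕ → Prop} {x : ℕ} (hx : x < n) :
    (tableStep n (fun T i => decide (f T i)) T)[x]? = some tt ↔ f T x := by
  simp [tableStep, hx]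

open Classical in
/-- `TStep` implements a round of the auction, as long as the prices fit into their bits. -/
theorem Describes.step {st : Auction} (h : Describes L R T st)
    (hp : ∀ r, st.price r ≤ rounds L R) :
    Describes L R (tableStep (R * width L R)
      (fun T i => decide (TStep L R act adj T i)) T) (st.step L R act adj) := by
  have hlt : ∀ r < R, ∀ y < width L R, r * width L R + y < R * width L R := by
    intro r hr y hy
    have := Nat.mul_le_mul_right (width L R) (Nat.succ_le_of_lt hr)
    rw [Nat.succ_mul] at this
    omega
  have hw : width L R = L + rounds L R := rfl
  refine fun r hr => ⟨fun u hu => ?_, fun p hpr => ?_⟩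
  · rw [TOwn, getElem?_tableStep (hlt r hr u (by omega))]
    constructor
    · rintro ⟨r', hr', ⟨u', hu', he, hb⟩ | ⟨p, hp', he, -⟩⟩
      · obtain ⟨rfl, rfl⟩ := eq_and_eq_of_mul_add_eq (by omega) (by omega) he
        rwa [h.bid_iff hp hu hr, (h r hr).1 u hu, h.exists_bid_iff hp hr] at hb
      · have := eq_and_eq_of_mul_add_eq (by omega) (by omega) he
        omega
    · intro hb
      refine ⟨r, hr, Or.inl ⟨u, hu, rfl, ?_⟩⟩
      rw [h.bid_iff hp hu hr, (h r hr).1 u hu, h.exists_bid_iff hp hr]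
      exact hb
  · rw [TPrice, getElem?_tableStep (hlt r hr (L + p) (by omega))]
    have key : (TPrice L R T r p ∨ ((∃ u' < L, TBid L R act adj T u' r) ∧
        (p = 0 ∨ TPrice L R T r (p - 1)))) ↔ p < (st.step L R act adj).price r := by
      rw [(h r hr).2 p hpr, (h r hr).2 (p - 1) (by omega), h.exists_bid_iff hp hr]
      simp only [Auction.step]
      split_ifs with hb
      · simp only [hb, true_and]
        omega
      · simp [hb]
    rw [← key]
    constructor
    · rintro ⟨r', hr', ⟨u', hu', he, -⟩ | ⟨p, hp', he, hb⟩⟩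
      · have := eq_and_eq_of_mul_add_eq (by omega) (by omega) he
        omega
      · obtain ⟨rfl, h2⟩ := eq_and_eq_of_mul_add_eq (by omega) (by omega) he
        obtain rfl := Nat.add_left_cancel h2
        exact hb
    · exact fun hb => ⟨r, hr, Or.inr ⟨p, hpr, rfl, hb⟩⟩

open Classical in
theorem describes_iterate (t : ℕ) (ht : t ≤ rounds L R) :
    Describes L R ((tableStep (R * width L R)
      (fun T i => decide (TStep L R act adj T i)))^[t] []) (run L R act adj t) := by
  induction t with
  | zero => exact fun r _ => ⟨fun u _ => by simp [TOwn, run], fun p _ => by simp [TPrice, run]⟩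
  | succ t ih =>
    rw [Function.iterate_succ_apply', run_succ]
    exact (ih (by omega)).step fun r => (price_run_le t r).trans (by omega)

open Classical in
/-- The matching problem is decided by an iterated operation on tables. -/
theorem matchable_iff_table : Matchable L R act adj ↔ ∀ u < L, ¬TUnmatched L R act
    ((tableStep (R * width L R) (fun T i => decide (TStep L R act adj T i)))^[rounds L R] []) u := by
  rw [← run_matched_iff]
  have h := describes_iterate (L := L) (R := R) (act := act) (adj := adj) _ le_rfl
  constructor
  · exact fun hm u hu hu' => hm u ((h.unmatched_iff hu).1 hu')
  · exact fun hm u hu => hm u hu.1 ((h.unmatched_iff hu.1).2 hu)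

end Table

section Feasible

variable {α β : Type} [Context α] [Context β] {L R : α → ℕ} {act : α → ℕ → Prop}
  {adj : α → ℕ → ℕ → Prop} {π : β → α} {T : β → List Symbol} {g h : β → ℕ}

theorem feasible_rounds (hL : Feasible L) (hR : Feasible R) :
    Feasible fun a => rounds (L a) (R a) := (hR.mul hL).add (.const 1)

theorem feasible_width (hL : Feasible L) (hR : Feasible R) :
    Feasible fun a => width (L a) (R a) := hL.add (feasible_rounds hL hR)

theorem feasiblePred_tOwn (hL : Feasible L) (hR : Feasible R) (hπ : IsProj π) (hT : IsVar T)
    (hg : Feasible g) (hh : Feasible h) :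
    FeasiblePred fun b => TOwn (L (π b)) (R (π b)) (T b) (g b) (h b) :=
  FeasiblePred.get_eq_tt hT ((hg.mul ((feasible_width hL hR).proj hπ)).add hh)

theorem feasiblePred_tPrice (hL : Feasible L) (hR : Feasible R) (hπ : IsProj π) (hT : IsVar T)
    (hg : Feasible g) (hh : Feasible h) :
    FeasiblePred fun b => TPrice (L (π b)) (R (π b)) (T b) (g b) (h b) :=
  FeasiblePred.get_eq_tt hT
    ((hg.mul ((feasible_width hL hR).proj hπ)).add ((hL.proj hπ).add hh))

theorem feasiblePred_tUnmatched (hL : Feasible L) (hR : Feasible R)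
    (hact : FeasiblePred fun x : α × ℕ => act x.1 x.2) (hπ : IsProj π) (hT : IsVar T)
    (hg : Feasible g) :
    FeasiblePred fun b => TUnmatched (L (π b)) (R (π b)) (act (π b)) (T b) (g b) := by
  unfold TUnmatched
  exact (hact.comp hπ hg).and (FeasiblePred.forall_lt (hR.proj hπ)
    (feasiblePred_tOwn hL hR hπ.wk (hT.proj .fst) .var0 hg.wk).not)

theorem feasiblePred_tCheapest (hL : Feasible L) (hR : Feasible R)
    (hadj : FeasiblePred fun x : (α × ℕ) × ℕ => adj x.1.1 x.1.2 x.2) (hπ : IsProj π)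
    (hT : IsVar T) (hg : Feasible g) (hh : Feasible h) :
    FeasiblePred fun b => TCheapest (L (π b)) (R (π b)) (adj (π b)) (T b) (g b) (h b) := by
  unfold TCheapest
  exact (hadj.comp₂ hπ hg hh).and (FeasiblePred.forall_lt (hR.proj hπ)
    ((hadj.comp₂ hπ.wk hg.wk .var0).imp
      (FeasiblePred.forall_lt ((feasible_rounds hL hR).proj hπ.wk)
        ((feasiblePred_tPrice hL hR hπ.wk.wk (hT.proj IsProj.fst.wk) hh.wk.wk .var0).imp
          (feasiblePred_tPrice hL hR hπ.wk.wk (hT.proj IsProj.fst.wk) .var1 .var0)))))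

theorem feasiblePred_tBid (hL : Feasible L) (hR : Feasible R)
    (hact : FeasiblePred fun x : α × ℕ => act x.1 x.2)
    (hadj : FeasiblePred fun x : (α × ℕ) × ℕ => adj x.1.1 x.1.2 x.2) (hπ : IsProj π)
    (hT : IsVar T) (hg : Feasible g) (hh : Feasible h) :
    FeasiblePred fun b =>
      TBid (L (π b)) (R (π b)) (act (π b)) (adj (π b)) (T b) (g b) (h b) := by
  unfold TBid
  exact ((feasiblePred_tUnmatched hL hR hact hπ hT hg).and
      (FeasiblePred.forall_lt hg
        (feasiblePred_tUnmatched hL hR hact hπ.wk (hT.proj .fst) .var0).not)).and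
    ((feasiblePred_tCheapest hL hR hadj hπ hT hg hh).and
      (FeasiblePred.forall_lt hh
        (feasiblePred_tCheapest hL hR hadj hπ.wk (hT.proj .fst) hg.wk .var0).not))

theorem feasiblePred_tStep (hL : Feasible L) (hR : Feasible R)
    (hact : FeasiblePred fun x : α × ℕ => act x.1 x.2)
    (hadj : FeasiblePred fun x : (α × ℕ) × ℕ => adj x.1.1 x.1.2 x.2) (hπ : IsProj π)
    (hT : IsVar T) (hg : Feasible g) :
    FeasiblePred fun b => TStep (L (π b)) (R (π b)) (act (π b)) (adj (π b)) (T b) (g b) := by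
  unfold TStep
  have hw := feasible_width hL hR
  have hT2 : IsVar fun x : (β × ℕ) × ℕ => T x.1.1 := hT.proj IsProj.fst.wk
  have hbid : FeasiblePred fun x : (β × ℕ) × ℕ => ∃ u' < L (π x.1.1),
      TBid (L (π x.1.1)) (R (π x.1.1)) (act (π x.1.1)) (adj (π x.1.1)) (T x.1.1) u' x.1.2 :=
    FeasiblePred.exists_lt (hL.proj hπ.wk.wk) (feasiblePred_tBid hL hR hact hadj hπ.wk.wk.wk
      (hT.proj IsProj.fst.wk.wk) .var0 .var2)
  exact FeasiblePred.exists_lt (hR.proj hπ) ((FeasiblePred.exists_lt (hL.proj hπ.wk)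
      ((hg.wk.wk.eq ((Feasible.var1.mul (hw.proj hπ.wk.wk)).add .var0)).and
        ((feasiblePred_tBid hL hR hact hadj hπ.wk.wk hT2 .var0 .var1).or
          ((feasiblePred_tOwn hL hR hπ.wk.wk hT2 .var1 .var0).and hbid.not)))).or
    (FeasiblePred.exists_lt ((feasible_rounds hL hR).proj hπ.wk)
      ((hg.wk.wk.eq ((Feasible.var1.mul (hw.proj hπ.wk.wk)).add
          ((hL.proj hπ.wk.wk).add .var0))).and
        ((feasiblePred_tPrice hL hR hπ.wk.wk hT2 .var1 .var0).or
          (hbid.and ((Feasible.var0.eq (.const 0)).or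
            (feasiblePred_tPrice hL hR hπ.wk.wk hT2 .var1 (Feasible.var0.sub (.const 1)))))))))

end Feasible

end Auction

/-- The existence of a matching in a feasible bipartite graph is feasible. -/
theorem feasiblePred_matchable {α : Type} [Context α] {L R : α → ℕ} {act : α → ℕ → Prop}
    {adj : α → ℕ → ℕ → Prop} (hL : Feasible L) (hR : Feasible R)
    (hact : FeasiblePred fun x : α × ℕ => act x.1 x.2)
    (hadj : FeasiblePred fun x : (α × ℕ) × ℕ => adj x.1.1 x.1.2 x.2) :
    FeasiblePred fun a => Matchable (L a) (R a) (act a) (adj a) := by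
  classical
  refine (FeasiblePred.iterate (c := fun a => Auction.rounds (L a) (R a))
    (l := fun a => R a * Auction.width (L a) (R a))
    (st := fun a T x => Auction.TStep (L a) (R a) (act a) (adj a) T x)
    (p := fun a T => ∀ u < L a, ¬Auction.TUnmatched (L a) (R a) (act a) T u)
    (Auction.feasible_rounds hL hR) (hR.mul (Auction.feasible_width hL hR))
    (Auction.feasiblePred_tStep hL hR hact hadj IsProj.fst.wk
      (isVar_snd.proj (IsProj.fst (τ := ℕ))) .var0)
    (FeasiblePred.forall_lt hL.wk (Auction.feasiblePred_tUnmatched hL hR hact IsProj.fst.wk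
      (isVar_snd.proj (IsProj.fst (τ := ℕ))) .var0).not)).congr fun a => ?_
  rw [Auction.matchable_iff_table]

/-! ### First and last candidates of completions -/

section Order

variable {m : ℕ}

/-- A maximal element of a partial order can be made the first of a linear extension. -/
theorem exists_linearOrder_first {P : Fin m → Fin m → Prop} (hP : IsPartialOrder (Fin m) P)
    {x : Fin m} (hx : ∀ b, P b x → b = x) :
    ∃ L : Fin m → Fin m → Prop, IsLinearOrder (Fin m) L ∧ (∀ a b, P a b → L a b) ∧ ∀ b, L x b := by
  have hP' : IsPartialOrder (Fin m) fun a b => P a b ∨ a = x :=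
    { refl := fun a => Or.inl (hP.refl a)
      trans := by
        rintro a b c (hab | rfl) (hbc | hb)
        · exact Or.inl (hP.trans a b c hab hbc)
        · subst hb
          exact Or.inr (hx a hab)
        · exact Or.inr rfl
        · exact Or.inr rfl
      antisymm := by
        rintro a b (hab | ha) (hba | hb)
        · exact hP.antisymm a b hab hba
        · subst hb
          exact hx a hab
        · subst ha
          exact (hx b hba).symm
        · rw [ha, hb] }
  obtain ⟨L, hL, hle⟩ := extend_partialOrder (fun a b => P a b ∨ a = x)
  exact ⟨L, hL, fun a b h => hle a b (Or.inl h), fun b => hle x b (Or.inr rfl)⟩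

theorem isPartialOrder_flip {P : Fin m → Fin m → Prop} (hP : IsPartialOrder (Fin m) P) :
    IsPartialOrder (Fin m) (flip P) where
  refl a := hP.refl a
  trans a b c h h' := hP.trans c b a h' h
  antisymm a b h h' := hP.antisymm a b h' h

theorem isLinearOrder_flip {P : Fin m → Fin m → Prop} (hP : IsLinearOrder (Fin m) P) :
    IsLinearOrder (Fin m) (flip P) where
  toIsPartialOrder := isPartialOrder_flip hP.toIsPartialOrder
  total a b := hP.total b a

theorem exists_first {L : Fin m → Fin m → Prop} (hL : IsLinearOrder (Fin m) L) (hm : 0 < m) :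
    ∃ x, ∀ b, L x b := by
  let r : Fin m → Fin m → Prop := fun a b => L a b ∧ a ≠ b
  have : IsTrans (Fin m) r := ⟨fun a b c h h' => ⟨hL.trans a b c h.1 h'.1, by
    rintro rfl
    exact h.2 (hL.antisymm a b h.1 h'.1)⟩⟩
  have : Std.Irrefl r := ⟨fun a h => h.2 rfl⟩
  obtain ⟨x, -, hx⟩ := (Finite.wellFounded_of_trans_of_irrefl r).has_min Set.univ ⟨⟨0, hm⟩, trivial⟩
  refine ⟨x, fun b => ?_⟩
  rcases eq_or_ne b x with rfl | hb
  · exact hL.refl b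
  · exact (hL.total x b).resolve_right fun h => hx b trivial ⟨h, hb⟩

theorem position_eq_card_add_one (R : Fin m → Fin m → Prop) (a : Fin m)
    [DecidablePred fun b => b ≠ a ∧ R b a] :
    position R a = (Finset.univ.filter fun b => b ≠ a ∧ R b a).card + 1 := by
  unfold position
  congr

theorem position_congr {R R' : Fin m → Fin m → Prop} {a : Fin m} (h : ∀ b, R b a ↔ R' b a) :
    position R a = position R' a := by
  classical
  rw [position_eq_card_add_one R, position_eq_card_add_one R']
  congr 2
  exact Finset.filter_congr fun b _ => by rw [h b]

theorem position_eq_one_iff {L : Fin m → Fin m → Prop} (hL : IsLinearOrder (Fin m) L)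
    {x : Fin m} (hx : ∀ b, L x b) (a : Fin m) : position L a = 1 ↔ x = a := by
  classical
  simp only [position, Nat.add_eq_right, Finset.card_eq_zero, Finset.filter_eq_empty_iff,
    Finset.mem_univ, true_imp_iff, not_and]
  constructor
  · intro h
    by_contra hxa
    exact h hxa (hx a)
  · rintro rfl b hb h
    exact hb (hL.antisymm b x h (hx b))

theorem position_eq_card_iff {L : Fin m → Fin m → Prop} (hL : IsLinearOrder (Fin m) L)
    {x : Fin m} (hx : ∀ b, L b x) (a : Fin m) : position L a = m ↔ x = a := by
  classical
  have hsub : (Finset.univ.filter fun b => b ≠ a ∧ L b a) ⊆ Finset.univ.erase a := by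
    intro b hb
    simpa using (Finset.mem_filter.1 hb).2.1
  have hcard : (Finset.univ.erase a).card + 1 = m := by
    rw [Finset.card_erase_add_one (Finset.mem_univ a), Finset.card_univ, Fintype.card_fin]
  have hpos := position_eq_card_add_one L a
  constructor
  · intro h
    have h1 := Finset.eq_of_subset_of_card_le hsub (by omega)
    by_contra hxa
    have h2 : x ∈ Finset.univ.erase a := by simp [hxa]
    rw [← h1] at h2
    exact hxa (hL.antisymm x a (Finset.mem_filter.1 h2).2.2 (hx a))
  · rintro rfl
    have h1 : (Finset.univ.filter fun b => b ≠ x ∧ L b x) = Finset.univ.erase x := by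
      ext b
      simp [hx b]
    rw [h1] at hpos
    exact hpos.trans hcard

end Order

/-- The number of voters that select `a`. -/
def cnt {m n : ℕ} (t : Fin n → Fin m) (a : Fin m) : ℕ := (Finset.univ.filter fun i => t i = a).card

theorem totalScore_plurality {m n : ℕ} {T : Fin n → Fin m → Fin m → Prop}
    (hT : ∀ i, IsLinearOrder (Fin m) (T i)) {t : Fin n → Fin m} (ht : ∀ i b, T i (t i) b)
    (a : Fin m) : totalScore plurality T a = cnt t a := by
  simp only [totalScore, plurality, cnt, Finset.card_filter]
  exact Finset.sum_congr rfl fun i _ => by simp only [position_eq_one_iff (hT i) (ht i)]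

/-- The veto score is the number of voters less the number of vetoes, which are here the votes `t`
for last places. -/
theorem totalScore_veto {m n : ℕ} {T : Fin n → Fin m → Fin m → Prop}
    (hT : ∀ i, IsLinearOrder (Fin m) (T i)) {t : Fin n → Fin m} (ht : ∀ i b, T i b (t i))
    (a : Fin m) : totalScore veto T a + cnt t a = n := by
  simp only [totalScore, veto, cnt, Finset.card_filter, position_eq_card_iff (hT _) (ht _)]
  rw [← Finset.sum_add_distrib]
  refine (Finset.sum_congr rfl fun i _ => ?_).trans (?_ : ∑ _i : Fin n, 1 = n)
  · split_ifs <;> rfl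
  · simp

theorem minRank_lt_iff (r : PositionalScoringRule) {m n : ℕ} {P : Fin n → Fin m → Fin m → Prop}
    (hP : ∀ i, IsPartialOrder (Fin m) (P i)) (tie : Fin m → Fin m → Prop) (c : Fin m) (k : ℕ) :
    minRank r P tie c < k ↔ ∃ T, IsCompletion P T ∧ rank r T tie c < k := by
  constructor
  · intro h
    obtain ⟨T, hT, he⟩ := Nat.sInf_mem (ranks_nonempty r P hP tie c)
    exact ⟨T, hT, he ▸ h⟩
  · rintro ⟨T, hT, h⟩
    exact (Nat.sInf_le (s := ranks r P tie c) ⟨T, hT, rfl⟩).trans_lt h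

/-- With the votes `t` for first places, `b` comes before `c` in the result. -/
def BeatsByVotes {m n : ℕ} (tie : Fin m → Fin m → Prop) (t : Fin n → Fin m) (b c : Fin m) : Prop :=
  cnt t c < cnt t b ∨ (cnt t b = cnt t c ∧ tie b c)

/-- With the vetoes `t`, `b` comes before `c` in the result. -/
def BeatsByVetoes {m n : ℕ} (tie : Fin m → Fin m → Prop) (t : Fin n → Fin m) (b c : Fin m) :
    Prop :=
  cnt t b < cnt t c ∨ (cnt t b = cnt t c ∧ tie b c)

open Classical in
/-- Only the first places of the completions matter for plurality. -/
theorem minRank_plurality_lt_iff {m n : ℕ} {P : Fin n → Fin m → Fin m → Prop}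
    (hP : ∀ i, IsPartialOrder (Fin m) (P i)) (tie : Fin m → Fin m → Prop) (c : Fin m) (k : ℕ) :
    minRank plurality P tie c < k ↔ ∃ t : Fin n → Fin m, (∀ i b, P i b (t i) → b = t i) ∧
      (Finset.univ.filter fun b => b ≠ c ∧ BeatsByVotes tie t b c).card + 1 < k := by
  rw [minRank_lt_iff _ hP]
  have hrank : ∀ T : Fin n → Fin m → Fin m → Prop, (∀ i, IsLinearOrder (Fin m) (T i)) →
      ∀ t : Fin n → Fin m, (∀ i b, T i (t i) b) → rank plurality T tie c =
        (Finset.univ.filter fun b => b ≠ c ∧ BeatsByVotes tie t b c).card + 1 := by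
    intro T hT t ht
    rw [← position_eq_card_add_one]
    refine position_congr fun b => ?_
    unfold resultOrder BeatsByVotes
    simp only [totalScore_plurality hT ht]
  constructor
  · rintro ⟨T, hT, h⟩
    choose t ht using fun i => exists_first (hT i).1 c.pos
    refine ⟨t, fun i b hb => (hT i).1.antisymm b (t i) ((hT i).2 _ _ hb) (ht i b), ?_⟩
    rwa [← hrank T (fun i => (hT i).1) t ht]
  · rintro ⟨t, ht, h⟩
    choose T hT hle hfirst using fun i => exists_linearOrder_first (hP i) (ht i)
    exact ⟨T, fun i => ⟨hT i, hle i⟩, by rwa [hrank T hT t hfirst]⟩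

open Classical in
/-- Only the last places of the completions matter for veto. -/
theorem minRank_veto_lt_iff {m n : ℕ} {P : Fin n → Fin m → Fin m → Prop}
    (hP : ∀ i, IsPartialOrder (Fin m) (P i)) (tie : Fin m → Fin m → Prop) (c : Fin m) (k : ℕ) :
    minRank veto P tie c < k ↔ ∃ t : Fin n → Fin m, (∀ i b, P i (t i) b → b = t i) ∧
      (Finset.univ.filter fun b => b ≠ c ∧ BeatsByVetoes tie t b c).card + 1 < k := by
  rw [minRank_lt_iff _ hP]
  have hrank : ∀ T : Fin n → Fin m → Fin m → Prop, (∀ i, IsLinearOrder (Fin m) (T i)) →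
      ∀ t : Fin n → Fin m, (∀ i b, T i b (t i)) → rank veto T tie c =
        (Finset.univ.filter fun b => b ≠ c ∧ BeatsByVetoes tie t b c).card + 1 := by
    intro T hT t ht
    rw [← position_eq_card_add_one]
    refine position_congr fun b => ?_
    have hb := totalScore_veto hT ht b
    have hc := totalScore_veto hT ht c
    have h1 : totalScore veto T c < totalScore veto T b ↔ cnt t b < cnt t c := by omega
    have h2 : totalScore veto T b = totalScore veto T c ↔ cnt t b = cnt t c := by omega
    unfold resultOrder BeatsByVetoes
    rw [h1, h2]
  constructor
  · rintro ⟨T, hT, h⟩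
    choose t ht using fun i => exists_first (isLinearOrder_flip (hT i).1) c.pos
    refine ⟨t, fun i b hb => (hT i).1.antisymm b (t i) (ht i b) ((hT i).2 _ _ hb), ?_⟩
    rwa [← hrank T (fun i => (hT i).1) t ht]
  · rintro ⟨t, ht, h⟩
    choose T hT hle hlast using fun i =>
      exists_linearOrder_first (isPartialOrder_flip (hP i)) (ht i)
    exact ⟨fun i => flip (T i), fun i => ⟨isLinearOrder_flip (hT i), fun a b => hle i b a⟩, by
      rwa [hrank _ (fun i => isLinearOrder_flip (hT i)) t hlast]⟩

/-! ### Reduction to bipartite matching -/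

namespace Election

/-- Voter `i` can put candidate `a` first. -/
def First (I : Election) (i a : ℕ) : Prop := a < I.m ∧ ∀ b < I.m, I.Pref i b a → b = a

/-- Voter `i` can put candidate `a` last. -/
def Last (I : Election) (i a : ℕ) : Prop := a < I.m ∧ ∀ b < I.m, I.Pref i a b → b = a

theorem first_iff (I : Election) (i : Fin I.n) (a : Fin I.m) :
    I.First i a ↔ ∀ b, I.pref i b a → b = a :=
  ⟨fun h b hb => Fin.ext (h.2 b b.2 ((I.pref_iff i b a).2 hb)),
    fun h => ⟨a.2, fun b hb hp => congrArg Fin.val (h ⟨b, hb⟩ ((I.pref_iff i ⟨b, hb⟩ a).1 hp))⟩⟩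

theorem last_iff (I : Election) (i : Fin I.n) (a : Fin I.m) :
    I.Last i a ↔ ∀ b, I.pref i a b → b = a :=
  ⟨fun h b hb => Fin.ext (h.2 b b.2 ((I.pref_iff i a b).2 hb)),
    fun h => ⟨a.2, fun b hb hp => congrArg Fin.val (h ⟨b, hb⟩ ((I.pref_iff i a ⟨b, hb⟩).1 hp))⟩⟩

theorem exists_last (I : Election) (i : Fin I.n) : ∃ a : Fin I.m, I.Last i a := by
  have := I.pref_partialOrder i
  obtain ⟨L, hL, hle⟩ := extend_partialOrder (I.pref i)
  obtain ⟨x, hx⟩ := exists_first (isLinearOrder_flip hL) I.candidate.pos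
  exact ⟨x, (I.last_iff i x).2 fun b hb => hL.antisymm b x (hx b) (hle x b hb)⟩

/-- There are votes under which only candidates of `S` beat the distinguished one. -/
def GoodVotes (I : Election) (S : ℕ → Prop) : Prop :=
  ∃ t : Fin I.n → Fin I.m, (∀ i : Fin I.n, I.First i (t i)) ∧
    ∀ b, b ≠ I.candidate → BeatsByVotes I.tie t b I.candidate → S b

/-- There are vetoes under which only candidates of `S` beat the distinguished one. -/
def GoodVetoes (I : Election) (S : ℕ → Prop) : Prop :=
  ∃ t : Fin I.n → Fin I.m, (∀ i : Fin I.n, I.Last i (t i)) ∧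
    ∀ b, b ≠ I.candidate → BeatsByVetoes I.tie t b I.candidate → S b

open Classical in
/-- The largest possible number of votes for the distinguished candidate. -/
noncomputable def maxVotes (I : Election) : ℕ :=
  ((Finset.range I.n).filter fun i => I.First i I.candidate).card

open Classical in
/-- The smallest possible number of vetoes against the distinguished candidate. -/
noncomputable def minVetoes (I : Election) : ℕ :=
  ((Finset.range I.n).filter fun i => ∀ a < I.m, I.Last i a → a = I.candidate).card

/-- Voter `i` may take the `j`-th of the places of candidate `a`, which is numbered `a * n + j`.
The distinguished candidate and those of `S` have `n` places, and any other candidate has as many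
places as it may have votes without beating the distinguished one. -/
def VoteAdj (I : Election) (S : ℕ → Prop) (i x : ℕ) : Prop :=
  ∃ a < I.m, ∃ j < I.n, x = a * I.n + j ∧ I.First i a ∧
    (a = I.candidate ∨ S a ∨ (¬I.Tie a I.candidate ∧ j < I.maxVotes) ∨
      j + 1 < I.maxVotes)

/-- The `j`-th demand of a candidate `a` for a veto is numbered `a * (n + 1) + j`. A candidate
outside of `S` demands as many vetoes as it needs in order not to beat the distinguished one. -/
def VetoDemand (I : Election) (S : ℕ → Prop) (x : ℕ) : Prop :=
  ∃ a < I.m, ∃ j < I.n + 1, x = a * (I.n + 1) + j ∧ a ≠ I.candidate ∧ ¬S a ∧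
    (j < I.minVetoes ∨ (I.Tie a I.candidate ∧ j ≤ I.minVetoes))

/-- Voter `i` can satisfy the demand `x`. -/
def VetoAdj (I : Election) (x i : ℕ) : Prop :=
  ∃ a < I.m, ∃ j < I.n + 1, x = a * (I.n + 1) + j ∧ I.Last i a

theorem card_filter_range {n : ℕ} (p : ℕ → Prop) [DecidablePred p] :
    ((Finset.range n).filter p).card = (Finset.univ.filter fun i : Fin n => p i).card := by
  rw [← Finset.card_map Fin.valEmbedding]
  congr 1
  ext x
  simp only [Finset.mem_filter, Finset.mem_range, Finset.mem_map, Finset.mem_univ, true_and,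
    Fin.valEmbedding_apply]
  exact ⟨fun ⟨h1, h2⟩ => ⟨⟨x, h1⟩, h2, rfl⟩, fun ⟨i, h1, h2⟩ => h2 ▸ ⟨i.2, h1⟩⟩

/-- It is best to give the distinguished candidate all the votes that it can get. Then the others
must be matched to their places. The last condition is about a distinguished candidate without
votes: any candidate that the tiebreaker prefers then beats it, with or without votes. -/
theorem goodVotes_iff (I : Election) (S : ℕ → Prop) : I.GoodVotes S ↔
    Matchable I.n (I.m * I.n) (fun _ => True) (I.VoteAdj S) ∧
      ∀ a < I.m, a ≠ I.candidate → ¬S a → I.Tie a I.candidate → 1 ≤ I.maxVotes := by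
  classical
  have hs : I.maxVotes = (Finset.univ.filter fun i : Fin I.n => I.First i I.candidate).card := by
    rw [maxVotes, card_filter_range]
  constructor
  · rintro ⟨t, ht, hbeat⟩
    have hc : cnt t I.candidate ≤ I.maxVotes := by
      rw [hs]
      refine Finset.card_le_card fun i hi => ?_
      have := ht i
      simp only [Finset.mem_filter, Finset.mem_univ, true_and] at hi ⊢
      rwa [hi] at this
    have hcap : ∀ b, b ≠ I.candidate → ¬S b →
        cnt t b ≤ I.maxVotes ∧ (I.Tie b I.candidate → cnt t b < I.maxVotes) := by
      intro b hb hS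
      have h1 : ¬BeatsByVotes I.tie t b I.candidate := fun h => hS (hbeat b hb h)
      simp only [BeatsByVotes, not_or, not_and, ← I.tie_iff] at h1
      refine ⟨by omega, fun h => ?_⟩
      have : cnt t b ≠ cnt t I.candidate := fun h2 => h1.2 h2 h
      omega
    constructor
    · -- voter `i` takes the place of `t i` numbered by the earlier voters with the same vote
      let idx : Fin I.n → ℕ := fun i => (Finset.univ.filter fun i' => t i' = t i ∧ i' < i).card
      have hidx : ∀ i, idx i < cnt t (t i) := by
        intro i
        refine Finset.card_lt_card ((Finset.ssubset_iff_of_subset ?_).2 ⟨i, by simp, by simp⟩)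
        intro i' hi'
        simp only [Finset.mem_filter, Finset.mem_univ, true_and] at hi' ⊢
        exact hi'.1
      have hlt : ∀ i i', i < i' → t i = t i' → idx i < idx i' := by
        intro i i' hii he
        refine Finset.card_lt_card ((Finset.ssubset_iff_of_subset ?_).2
          ⟨i, by simp [he, hii], by simp⟩)
        intro j hj
        simp only [Finset.mem_filter, Finset.mem_univ, true_and] at hj ⊢
        exact ⟨hj.1.trans he, hj.2.trans hii⟩
      have hcn : ∀ a, cnt t a ≤ I.n := fun a => (Finset.card_filter_le _ _).trans (by simp)
      refine ⟨fun u => if h : u < I.n then t ⟨u, h⟩ * I.n + idx ⟨u, h⟩ else 0,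
        fun u hu _ => ?_, fun u hu u' hu' _ _ he => ?_⟩
      · have h1 := hidx ⟨u, hu⟩
        have h2 := h1.trans_le (hcn _)
        simp only [hu, dif_pos]
        constructor
        · have h3 := Nat.mul_le_mul_right I.n (Nat.succ_le_of_lt (t ⟨u, hu⟩).2)
          rw [Nat.succ_mul] at h3
          omega
        · refine ⟨_, (t ⟨u, hu⟩).2, _, h2, rfl, ht ⟨u, hu⟩, ?_⟩
          by_cases h3 : t ⟨u, hu⟩ = I.candidate
          · exact Or.inl (congrArg Fin.val h3)
          by_cases h4 : S (t ⟨u, hu⟩)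
          · exact Or.inr (Or.inl h4)
          have h5 := hcap _ h3 h4
          by_cases h6 : I.Tie (t ⟨u, hu⟩) I.candidate
          · have := h5.2 h6
            exact Or.inr (Or.inr (Or.inr (by omega)))
          · exact Or.inr (Or.inr (Or.inl ⟨h6, by omega⟩))
      · simp only [hu, hu', dif_pos] at he
        obtain ⟨h1, h2⟩ := Auction.eq_and_eq_of_mul_add_eq ((hidx _).trans_le (hcn _))
          ((hidx _).trans_le (hcn _)) he
        rcases lt_trichotomy u u' with h | h | h
        · exact absurd h2 (hlt ⟨u, hu⟩ ⟨u', hu'⟩ h (Fin.ext h1)).ne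
        · exact h
        · exact absurd h2 (hlt ⟨u', hu'⟩ ⟨u, hu⟩ h (Fin.ext h1.symm)).ne'
    · intro a ha hac hS htie
      have := (hcap ⟨a, ha⟩ (fun h => hac (congrArg Fin.val h)) hS).2 htie
      omega
  · rintro ⟨⟨f, hf, hinj⟩, h1⟩
    have hplace : ∀ i : Fin I.n, ∃ (a : Fin I.m) (j : ℕ), j < I.n ∧ f i = a * I.n + j ∧
        I.First i a ∧ (a = I.candidate ∨ S a ∨ (¬I.Tie a I.candidate ∧ j < I.maxVotes) ∨
          j + 1 < I.maxVotes) := by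
      intro i
      obtain ⟨-, a, ha, j, hj, h2, h3, h4⟩ := hf i i.2 trivial
      exact ⟨⟨a, ha⟩, j, hj, h2, h3, h4.imp_left fun h => Fin.ext h⟩
    choose p j hj hfp hfirst hcap using hplace
    -- every voter who can put the distinguished candidate first does so
    let t : Fin I.n → Fin I.m := fun i => if I.First i I.candidate then I.candidate else p i
    have hc : cnt t I.candidate = I.maxVotes := by
      rw [hs, cnt]
      congr 1
      ext i
      simp only [Finset.mem_filter, Finset.mem_univ, true_and, t]
      split_ifs with h
      · simp [h]
      · refine iff_of_false (fun h2 => h ?_) h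
        have := hfirst i
        rwa [h2] at this
    refine ⟨t, fun i => ?_, fun b hb hbeat => ?_⟩
    · simp only [t]
      split_ifs with h
      · exact h
      · exact hfirst i
    · by_contra hS
      have hp : ∀ i, t i = b → p i = b := by
        intro i hi
        simp only [t] at hi
        split_ifs at hi with h
        · exact absurd hi.symm hb
        · exact hi
      have hcount : ∀ cap : ℕ, (∀ i, p i = b → j i < cap) → cnt t b ≤ cap := by
        intro cap hlt
        rw [← Finset.card_range cap]
        refine Finset.card_le_card_of_injOn j (fun i hi => ?_) fun i hi i' hi' he => ?_
        · simp only [Finset.coe_filter, Finset.mem_univ, true_and, Set.mem_ofPred_eq] at hi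
          exact Finset.mem_coe.2 (Finset.mem_range.2 (hlt i (hp i hi)))
        · simp only [Finset.coe_filter, Finset.mem_univ, true_and, Set.mem_ofPred_eq] at hi hi'
          refine Fin.ext (hinj i i.2 i' i'.2 trivial trivial ?_)
          rw [hfp, hfp, hp i hi, hp i' hi', he]
      by_cases htie : I.Tie b I.candidate
      · have h2 := hcount (I.maxVotes - 1) fun i hi => by
          rcases hcap i with h | h | h | h
          · exact absurd (hi.symm.trans h) hb
          · exact absurd (hi ▸ h) hS
          · exact absurd (hi ▸ htie) h.1
          · omega
        have h3 := h1 b b.2 (fun h => hb (Fin.ext h)) hS htie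
        rcases hbeat with h | h <;> omega
      · have h2 := hcount I.maxVotes fun i hi => by
          rcases hcap i with h | h | h | h
          · exact absurd (hi.symm.trans h) hb
          · exact absurd (hi ▸ h) hS
          · exact h.2
          · omega
        rcases hbeat with h | h
        · omega
        · exact htie ((I.tie_iff _ _).2 h.2)

theorem _root_.Finset.exists_injOn_of_card (F : Finset ℕ) : ∃ e : ℕ → ℕ, (∀ j < F.card, e j ∈ F) ∧
    ∀ j < F.card, ∀ j' < F.card, e j = e j' → j = j' := by
  refine ⟨fun j => if h : j < F.card then F.equivFin.symm ⟨j, h⟩ else 0, fun j hj => ?_,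
    fun j hj j' hj' he => ?_⟩
  · simp [hj]
  · simp only [hj, hj', dif_pos] at he
    simpa using F.equivFin.symm.injective (Subtype.ext he)

/-- It is best to let only those voters veto the distinguished candidate who have no other choice.
A voter who satisfies no demand may be used to veto any candidate but the distinguished one. -/
theorem goodVetoes_iff (I : Election) (S : ℕ → Prop) : I.GoodVetoes S ↔
    Matchable (I.m * (I.n + 1)) I.n (I.VetoDemand S) I.VetoAdj := by
  classical
  have hs : I.minVetoes =
      (Finset.univ.filter fun i : Fin I.n => ∀ a < I.m, I.Last i a → a = I.candidate).card := by
    rw [minVetoes, card_filter_range]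
  have hsn : I.minVetoes ≤ I.n := by
    rw [hs]
    exact (Finset.card_filter_le _ _).trans (by simp)
  constructor
  · rintro ⟨t, ht, hbeat⟩
    have hc : I.minVetoes ≤ cnt t I.candidate := by
      rw [hs]
      refine Finset.card_le_card fun i hi => ?_
      simp only [Finset.mem_filter, Finset.mem_univ, true_and] at hi ⊢
      exact Fin.ext (hi _ (t i).2 (ht i))
    have hcap : ∀ b, b ≠ I.candidate → ¬S b →
        I.minVetoes ≤ cnt t b ∧ (I.Tie b I.candidate → I.minVetoes < cnt t b) := by
      intro b hb hS
      have h1 : ¬BeatsByVetoes I.tie t b I.candidate := fun h => hS (hbeat b hb h)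
      simp only [BeatsByVetoes, not_or, not_and, ← I.tie_iff] at h1
      refine ⟨by omega, fun h => ?_⟩
      have : cnt t b ≠ cnt t I.candidate := fun h2 => h1.2 h2 h
      omega
    have hcard : ∀ b, ((Finset.univ.filter fun i => t i = b).map Fin.valEmbedding).card =
        cnt t b := fun b => Finset.card_map _
    choose e he hinj using fun b =>
      Finset.exists_injOn_of_card ((Finset.univ.filter fun i => t i = b).map Fin.valEmbedding)
    have he' : ∀ b, ∀ j < cnt t b, ∃ h : e b j < I.n, t ⟨e b j, h⟩ = b := by
      intro b j hj
      have := he b j (by rwa [hcard])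
      simp only [Finset.mem_map, Finset.mem_filter, Finset.mem_univ, true_and,
        Fin.valEmbedding_apply] at this
      obtain ⟨i, hi, h2⟩ := this
      exact ⟨h2 ▸ i.2, by simpa [← h2] using hi⟩
    have hdem : ∀ x, I.VetoDemand S x → ∃ (a : Fin I.m) (j : ℕ), j < I.n + 1 ∧
        x = a * (I.n + 1) + j ∧ j < cnt t a := by
      rintro x ⟨a, ha, j, hj, hx, hac, hS, hjv⟩
      have h1 := hcap ⟨a, ha⟩ (fun h => hac (congrArg Fin.val h)) hS
      refine ⟨⟨a, ha⟩, j, hj, hx, ?_⟩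
      rcases hjv with h | ⟨h2, h3⟩
      · omega
      · have := h1.2 h2
        omega
    have hex : ∀ x, ∃ y, ∀ (a : Fin I.m) (j : ℕ), j < I.n + 1 → x = a * (I.n + 1) + j →
        y = e a j := by
      intro x
      by_cases h : ∃ (a : Fin I.m) (j : ℕ), j < I.n + 1 ∧ x = a * (I.n + 1) + j
      · obtain ⟨a, j, hj, hx⟩ := h
        refine ⟨e a j, fun a' j' hj' hx' => ?_⟩
        obtain ⟨h1, h2⟩ := Auction.eq_and_eq_of_mul_add_eq hj hj' (hx.symm.trans hx')
        rw [Fin.ext h1, h2]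
      · exact ⟨0, fun a j hj hx => absurd ⟨a, j, hj, hx⟩ h⟩
    choose f hf using hex
    refine ⟨f, fun x _ hx => ?_, fun x _ x' _ hx hx' hxx => ?_⟩
    · obtain ⟨a, j, hj, rfl, hjc⟩ := hdem x hx
      obtain ⟨h1, h2⟩ := he' a j hjc
      rw [hf _ a j hj rfl]
      refine ⟨h1, a, a.2, j, hj, rfl, ?_⟩
      have := ht ⟨e a j, h1⟩
      rwa [h2] at this
    · obtain ⟨a, j, hj, rfl, hjc⟩ := hdem x hx
      obtain ⟨a', j', hj', rfl, hjc'⟩ := hdem x' hx'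
      rw [hf _ a j hj rfl, hf _ a' j' hj' rfl] at hxx
      obtain ⟨h1, h2⟩ := he' a j hjc
      obtain ⟨h1', h2'⟩ := he' a' j' hjc'
      obtain rfl : a = a' := by
        rw [← h2, ← h2']
        exact congrArg t (Fin.ext hxx)
      rw [hinj a j (by rwa [hcard]) j' (by rwa [hcard]) hxx]
  · rintro ⟨f, hf, hinj⟩
    have hlt : ∀ (a : Fin I.m), ∀ j < I.n + 1, a * (I.n + 1) + j < I.m * (I.n + 1) := by
      intro a j hj
      have := Nat.mul_le_mul_right (I.n + 1) (Nat.succ_le_of_lt a.2)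
      rw [Nat.succ_mul] at this
      omega
    -- a voter without a demand vetoes the distinguished candidate only if there is no other choice
    have hg : ∀ i : Fin I.n, ∃ a : Fin I.m, I.Last i a ∧
        (a = I.candidate → ∀ b < I.m, I.Last i b → b = I.candidate) := by
      intro i
      by_cases h : ∃ b < I.m, I.Last i b ∧ b ≠ I.candidate
      · obtain ⟨b, hb, hl, hne⟩ := h
        exact ⟨⟨b, hb⟩, hl, fun h => absurd (congrArg Fin.val h) hne⟩
      · push Not at h
        obtain ⟨a, ha⟩ := I.exists_last i
        exact ⟨a, ha, fun _ => h⟩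
    choose g hgl hgc using hg
    have hsel : ∀ i : Fin I.n, ∃ a : Fin I.m, I.Last i a ∧
        (∀ (b : Fin I.m) (j : ℕ), j < I.n + 1 → I.VetoDemand S (b * (I.n + 1) + j) →
          f (b * (I.n + 1) + j) = i → a = b) ∧
        (a = I.candidate → ∀ b < I.m, I.Last i b → b = I.candidate) := by
      intro i
      by_cases h : ∃ (b : Fin I.m) (j : ℕ), j < I.n + 1 ∧ I.VetoDemand S (b * (I.n + 1) + j) ∧
          f (b * (I.n + 1) + j) = i
      · obtain ⟨b, j, hj, hd, hfi⟩ := h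
        refine ⟨b, ?_, fun b' j' hj' hd' hfi' => ?_, fun hbc => ?_⟩
        · obtain ⟨-, a, ha, j', hj', he, hl⟩ := hf _ (hlt b j hj) hd
          rw [(Auction.eq_and_eq_of_mul_add_eq hj hj' he).1, ← hfi]
          exact hl
        · have := hinj _ (hlt b j hj) _ (hlt b' j' hj') hd hd' (hfi.trans hfi'.symm)
          exact Fin.ext (Auction.eq_and_eq_of_mul_add_eq hj hj' this).1
        · obtain ⟨a, ha, j', hj', he, hne, -⟩ := hd
          rw [← (Auction.eq_and_eq_of_mul_add_eq hj hj' he).1] at hne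
          exact absurd (congrArg Fin.val hbc) hne
      · exact ⟨g i, hgl i, fun b j hj hd hfi => absurd ⟨b, j, hj, hd, hfi⟩ h, hgc i⟩
    choose t htl htd htc using hsel
    have hc : cnt t I.candidate ≤ I.minVetoes := by
      rw [hs]
      refine Finset.card_le_card fun i hi => ?_
      simp only [Finset.mem_filter, Finset.mem_univ, true_and] at hi ⊢
      exact htc i hi
    refine ⟨t, htl, fun b hb hbeat => ?_⟩
    by_contra hS
    have hbc : (b : ℕ) ≠ I.candidate := fun h => hb (Fin.ext h)
    have hcount : ∀ d ≤ I.n + 1, (∀ j < d, I.VetoDemand S (b * (I.n + 1) + j)) → d ≤ cnt t b := by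
      intro d hd hdem
      rw [cnt, ← Finset.card_map Fin.valEmbedding, ← Finset.card_range d]
      refine Finset.card_le_card_of_injOn (fun j => f (b * (I.n + 1) + j)) (fun j hj => ?_)
        fun j hj j' hj' he => ?_
      · have hj := Finset.mem_range.1 (Finset.mem_coe.1 hj)
        have h1 := (hf _ (hlt b j (by omega)) (hdem j hj)).1
        simp only [Finset.coe_map, Finset.coe_filter, Finset.mem_univ, true_and]
        exact ⟨⟨_, h1⟩, htd ⟨_, h1⟩ b j (by omega) (hdem j hj) rfl, rfl⟩
      · have hj := Finset.mem_range.1 (Finset.mem_coe.1 hj)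
        have hj' := Finset.mem_range.1 (Finset.mem_coe.1 hj')
        exact Nat.add_left_cancel (hinj _ (hlt b j (by omega)) _ (hlt b j' (by omega)) (hdem j hj)
          (hdem j' hj') he)
    have h1 := hcount I.minVetoes (by omega) fun j hj =>
      ⟨b, b.2, j, by omega, rfl, hbc, hS, Or.inl hj⟩
    rcases hbeat with h | ⟨h, htie⟩
    · omega
    · have h2 := hcount (I.minVetoes + 1) (by omega) fun j hj =>
        ⟨b, b.2, j, by omega, rfl, hbc, hS, Or.inr ⟨(I.tie_iff _ _).2 htie, by omega⟩⟩
      omega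

end Election

/-! ### Guessing the candidates that may beat the distinguished one -/

/-- `good` holds after adding `K` numbers below `m`, not necessarily distinct, to the set `S`. -/
def ExistsAdding (m : ℕ) (good : (ℕ → Prop) → Prop) : ℕ → (ℕ → Prop) → Prop
  | 0, S => good S
  | K + 1, S => ∃ d < m, ExistsAdding m good K fun x => S x ∨ x = d

/-- For a monotone property, the repetitions in `ExistsAdding` do no harm: they amount to sets of at
most `K` elements. -/
theorem existsAdding_iff {m : ℕ} (hm : 0 < m) {good : (ℕ → Prop) → Prop}
    (hmono : ∀ S S' : ℕ → Prop, (∀ x, S x → S' x) → good S → good S') :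
    ∀ (K : ℕ) (S : ℕ → Prop), ExistsAdding m good K S ↔
      ∃ F : Finset ℕ, F ⊆ Finset.range m ∧ F.card ≤ K ∧ good fun x => S x ∨ x ∈ F
  | 0, S => by
    constructor
    · exact fun h => ⟨∅, by simp, by simp, hmono _ _ (fun x hx => Or.inl hx) h⟩
    · rintro ⟨F, -, hF, h⟩
      obtain rfl := Finset.card_eq_zero.1 (Nat.le_zero.1 hF)
      exact hmono _ _ (fun x hx => by simpa using hx) h
  | K + 1, S => by
    rw [ExistsAdding]
    simp only [existsAdding_iff hm hmono K]
    constructor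
    · rintro ⟨d, hd, F, hF, hK, h⟩
      refine ⟨insert d F, Finset.insert_subset (Finset.mem_range.2 hd) hF,
        (Finset.card_insert_le _ _).trans (by omega), hmono _ _ (fun x hx => ?_) h⟩
      rw [Finset.mem_insert]
      tauto
    · rintro ⟨F, hF, hK, h⟩
      obtain rfl | ⟨d, hd⟩ := F.eq_empty_or_nonempty
      · exact ⟨0, hm, ∅, by simp, by simp, hmono _ _ (fun x hx => by simp_all) h⟩
      · refine ⟨d, Finset.mem_range.1 (hF hd), F.erase d, (Finset.erase_subset _ _).trans hF, ?_,
          hmono _ _ (fun x hx => ?_) h⟩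
        · rw [Finset.card_erase_of_mem hd]
          omega
        · rw [Finset.mem_erase]
          tauto

namespace Election

theorem minRank_plurality_lt_iff_existsAdding (I : Election) (K : ℕ) :
    minRank plurality I.pref I.tie I.candidate < K + 2 ↔
      ExistsAdding I.m I.GoodVotes K fun _ => False := by
  classical
  rw [minRank_plurality_lt_iff I.pref_partialOrder, existsAdding_iff I.candidate.pos
    (fun S S' h ⟨t, ht, hb⟩ => ⟨t, ht, fun b h1 h2 => h b (hb b h1 h2)⟩)]
  constructor
  · rintro ⟨t, ht, hcard⟩
    refine ⟨(Finset.univ.filter fun b => b ≠ I.candidate ∧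
      BeatsByVotes I.tie t b I.candidate).map Fin.valEmbedding, fun x hx => ?_, ?_, t,
      fun i => (I.first_iff i _).2 (ht i), fun b hb hbeat => Or.inr ?_⟩
    · obtain ⟨b, -, rfl⟩ := Finset.mem_map.1 hx
      exact Finset.mem_range.2 b.2
    · rw [Finset.card_map]
      convert Nat.le_of_lt_succ (Nat.lt_of_succ_lt_succ hcard)
    · exact Finset.mem_map.2 ⟨b, by simp [hb, hbeat], rfl⟩
  · rintro ⟨F, -, hF, t, ht, hbeat⟩
    refine ⟨t, fun i => (I.first_iff i _).1 (ht i), ?_⟩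
    refine Nat.succ_lt_succ (Nat.lt_succ_of_le (le_trans ?_ hF))
    refine Finset.card_le_card_of_injOn Fin.val (fun b hb => ?_) Fin.val_injective.injOn
    have hb := (Finset.mem_filter.1 (Finset.mem_coe.1 hb)).2
    exact (hbeat b hb.1 hb.2).resolve_left id

theorem minRank_veto_lt_iff_existsAdding (I : Election) (K : ℕ) :
    minRank veto I.pref I.tie I.candidate < K + 2 ↔
      ExistsAdding I.m I.GoodVetoes K fun _ => False := by
  classical
  rw [minRank_veto_lt_iff I.pref_partialOrder, existsAdding_iff I.candidate.pos
    (fun S S' h ⟨t, ht, hb⟩ => ⟨t, ht, fun b h1 h2 => h b (hb b h1 h2)⟩)]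
  constructor
  · rintro ⟨t, ht, hcard⟩
    refine ⟨(Finset.univ.filter fun b => b ≠ I.candidate ∧
      BeatsByVetoes I.tie t b I.candidate).map Fin.valEmbedding, fun x hx => ?_, ?_, t,
      fun i => (I.last_iff i _).2 (ht i), fun b hb hbeat => Or.inr ?_⟩
    · obtain ⟨b, -, rfl⟩ := Finset.mem_map.1 hx
      exact Finset.mem_range.2 b.2
    · rw [Finset.card_map]
      convert Nat.le_of_lt_succ (Nat.lt_of_succ_lt_succ hcard)
    · exact Finset.mem_map.2 ⟨b, by simp [hb, hbeat], rfl⟩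
  · rintro ⟨F, -, hF, t, ht, hbeat⟩
    refine ⟨t, fun i => (I.last_iff i _).1 (ht i), ?_⟩
    refine Nat.succ_lt_succ (Nat.lt_succ_of_le (le_trans ?_ hF))
    refine Finset.card_le_card_of_injOn Fin.val (fun b hb => ?_) Fin.val_injective.injOn
    have hb := (Finset.mem_filter.1 (Finset.mem_coe.1 hb)).2
    exact (hbeat b hb.1 hb.2).resolve_left id

/-! ### Feasibility of the reduction -/

theorem feasiblePred_first :
    FeasiblePred fun x : (Election × ℕ) × ℕ => x.1.1.First x.1.2 x.2 := by
  unfold First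
  exact (Feasible.var0.lt feasible_m.wk.wk).and (FeasiblePred.forall_lt feasible_m.wk.wk
    ((feasiblePred_pref.comp₃ IsProj.fst.wk.wk .var2 .var0 .var1).imp (Feasible.var0.eq .var1)))

theorem feasiblePred_last :
    FeasiblePred fun x : (Election × ℕ) × ℕ => x.1.1.Last x.1.2 x.2 := by
  unfold Last
  exact (Feasible.var0.lt feasible_m.wk.wk).and (FeasiblePred.forall_lt feasible_m.wk.wk
    ((feasiblePred_pref.comp₃ IsProj.fst.wk.wk .var2 .var1 .var0).imp (Feasible.var0.eq .var1)))

theorem feasible_maxVotes : Feasible maxVotes :=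
  feasible_n.card_filter (p := fun (I : Election) (i : ℕ) => I.First i I.candidate)
    (feasiblePred_first.comp₂ .fst .var0 feasible_candidate.wk)

theorem feasible_minVetoes : Feasible minVetoes :=
  (feasible_n.card_filter
    (p := fun (I : Election) (i : ℕ) => ∀ a < I.m, I.Last i a → a = I.candidate)
    (FeasiblePred.forall_lt feasible_m.wk
      ((feasiblePred_last.comp₂ IsProj.fst.wk .var1 .var0).imp
        (Feasible.var0.eq feasible_candidate.wk.wk)))).congr fun I => by
    unfold minVetoes
    congr!

section

variable {α : Type} [Context α] {π : α → Election} {S : α → ℕ → Prop}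

theorem feasiblePred_voteAdj (hπ : IsProj π) (hS : FeasiblePred fun x : α × ℕ => S x.1 x.2) :
    FeasiblePred fun x : (α × ℕ) × ℕ => (π x.1.1).VoteAdj (S x.1.1) x.1.2 x.2 := by
  have hπ4 : IsProj fun x : (((α × ℕ) × ℕ) × ℕ) × ℕ => π x.1.1.1.1 := hπ.wk.wk.wk.wk
  have hc := feasible_candidate.proj hπ4
  have hv := feasible_maxVotes.proj hπ4
  unfold VoteAdj
  exact FeasiblePred.exists_lt (feasible_m.proj hπ.wk.wk)
    (FeasiblePred.exists_lt (feasible_n.proj hπ.wk.wk.wk)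
      ((Feasible.var2.eq ((Feasible.var1.mul (feasible_n.proj hπ4)).add .var0)).and
        ((feasiblePred_first.comp₂ hπ4 .var3 .var1).and
          ((Feasible.var1.eq hc).or ((hS.comp IsProj.fst.wk.wk.wk .var1).or
            (((feasiblePred_tie.comp₂ hπ4 .var1 hc).not.and (Feasible.var0.lt hv)).or
              ((Feasible.var0.add (.const 1)).lt hv)))))))

theorem feasiblePred_goodVotes (hπ : IsProj π) (hS : FeasiblePred fun x : α × ℕ => S x.1 x.2) :
    FeasiblePred fun a => (π a).GoodVotes (S a) := by
  have hc := feasible_candidate.proj (hπ.wk (τ := ℕ))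
  simp only [goodVotes_iff]
  exact (feasiblePred_matchable (feasible_n.proj hπ)
    ((feasible_m.proj hπ).mul (feasible_n.proj hπ)) .true (feasiblePred_voteAdj hπ hS)).and
    (FeasiblePred.forall_lt (feasible_m.proj hπ)
      ((Feasible.var0.eq hc).not.imp (hS.not.imp ((feasiblePred_tie.comp₂ hπ.wk .var0 hc).imp
        ((Feasible.const 1).le (feasible_maxVotes.proj hπ.wk))))))

theorem feasiblePred_vetoDemand (hπ : IsProj π) (hS : FeasiblePred fun x : α × ℕ => S x.1 x.2) :
    FeasiblePred fun x : α × ℕ => (π x.1).VetoDemand (S x.1) x.2 := by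
  have hπ3 : IsProj fun x : ((α × ℕ) × ℕ) × ℕ => π x.1.1.1 := hπ.wk.wk.wk
  have hc := feasible_candidate.proj hπ3
  have hv := feasible_minVetoes.proj hπ3
  have hn := fun {β : Type} [Context β] {ρ : β → Election} (h : IsProj ρ) =>
    (feasible_n.proj h).add (.const 1)
  unfold VetoDemand
  exact FeasiblePred.exists_lt (feasible_m.proj hπ.wk) (FeasiblePred.exists_lt (hn hπ.wk.wk)
    ((Feasible.var2.eq ((Feasible.var1.mul (hn hπ3)).add .var0)).and
      ((Feasible.var1.eq hc).not.and ((hS.comp IsProj.fst.wk.wk .var1).not.and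
        ((Feasible.var0.lt hv).or
          ((feasiblePred_tie.comp₂ hπ3 .var1 hc).and (Feasible.var0.le hv)))))))

theorem feasiblePred_vetoAdj (hπ : IsProj π) :
    FeasiblePred fun x : (α × ℕ) × ℕ => (π x.1.1).VetoAdj x.1.2 x.2 := by
  have hn := fun {β : Type} [Context β] {ρ : β → Election} (h : IsProj ρ) =>
    (feasible_n.proj h).add (.const 1)
  unfold VetoAdj
  exact FeasiblePred.exists_lt (feasible_m.proj hπ.wk.wk)
    (FeasiblePred.exists_lt (hn hπ.wk.wk.wk)
      ((Feasible.var3.eq ((Feasible.var1.mul (hn hπ.wk.wk.wk.wk)).add .var0)).and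
        (feasiblePred_last.comp₂ hπ.wk.wk.wk.wk .var2 .var1)))

theorem feasiblePred_goodVetoes (hπ : IsProj π) (hS : FeasiblePred fun x : α × ℕ => S x.1 x.2) :
    FeasiblePred fun a => (π a).GoodVetoes (S a) := by
  simp only [goodVetoes_iff]
  exact feasiblePred_matchable
    ((feasible_m.proj hπ).mul ((feasible_n.proj hπ).add (.const 1))) (feasible_n.proj hπ)
    (feasiblePred_vetoDemand hπ hS) (feasiblePred_vetoAdj hπ)

end

/-- Guesses of a fixed number of candidates are nested bounded quantifiers. -/
theorem feasiblePred_existsAdding {good : Election → (ℕ → Prop) → Prop}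
    (hgood : ∀ {α : Type} [Context α] {π : α → Election} {S : α → ℕ → Prop}, IsProj π →
      (FeasiblePred fun x : α × ℕ => S x.1 x.2) → FeasiblePred fun a => good (π a) (S a)) (K : ℕ) :
    ∀ {α : Type} [Context α] {π : α → Election} {S : α → ℕ → Prop}, IsProj π →
      (FeasiblePred fun x : α × ℕ => S x.1 x.2) →
      FeasiblePred fun a => ExistsAdding (π a).m (good (π a)) K (S a) := by
  induction K with
  | zero => exact fun hπ hS => hgood hπ hS
  | succ K ih =>
    intro α _ π S hπ hS
    simp only [ExistsAdding]
    exact FeasiblePred.exists_lt (feasible_m.proj hπ)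
      (ih (S := fun (x : α × ℕ) y => S x.1 y ∨ y = x.2) hπ.wk
        ((hS.comp IsProj.fst.wk .var0).or (Feasible.var0.eq .var1)))

end Election

theorem FeasiblePred.polyTimeDecidable {Q : Election → Prop} (h : FeasiblePred Q) :
    PolyTimeDecidable Election.encode Q := by
  obtain ⟨e, he⟩ := h
  exact polyTimeDecidable_of_expr e he

end PartialVoting

open PartialVoting Election in
theorem mainTheorem4 (k : ℕ) (hk : 1 ≤ k) :
    PartialVoting.PolyTimeDecidable PartialVoting.Election.encode
      (fun I => PartialVoting.minRank PartialVoting.plurality I.pref I.tie I.candidate < k) ∧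
    PartialVoting.PolyTimeDecidable PartialVoting.Election.encode
      (fun I => PartialVoting.minRank PartialVoting.veto I.pref I.tie I.candidate < k) := by
  obtain rfl | ⟨K, rfl⟩ : k = 1 ∨ ∃ K, k = K + 2 := by
    rcases k with _ | _ | K
    · omega
    · exact Or.inl rfl
    · exact Or.inr ⟨K, rfl⟩
  · -- ranks are positive
    refine ⟨(FeasiblePred.false.congr fun I => ?_).polyTimeDecidable,
      (FeasiblePred.false.congr fun I => ?_).polyTimeDecidable⟩
    · rw [minRank_plurality_lt_iff I.pref_partialOrder]
      simp
    · rw [minRank_veto_lt_iff I.pref_partialOrder]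
      simp
  · exact ⟨((feasiblePred_existsAdding feasiblePred_goodVotes K .id .false).congr
        fun I => (I.minRank_plurality_lt_iff_existsAdding K).symm).polyTimeDecidable,
      ((feasiblePred_existsAdding feasiblePred_goodVetoes K .id .false).congr
        fun I => (I.minRank_veto_lt_iff_existsAdding K).symm).polyTimeDecidable⟩
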